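/- Let $r>0$ and let $\mathbb B_1,\mathbb B_2,\mathbb B_3\subset\mathbb R^3$ be the closed balls of radius $r$ centered at $A_1,A_2,A_3$. Assume that the balls are in general position, i.e. the smallest sphere through any two or three points of $\{A_1,A_2,A_3\}$ has radius different from $r$, and let $p\in\partial\mathbb B_1\cap\partial\mathbb B_2\cap\partial\mathbb B_3$. Definitions. For a compact convex set $C\subset\mathbb R^3$ the normal cycle $N(C)$ is the integration $2$-current over the unit normal bundle $S(C)=\{(q,n):q\in\partial C,\ \|n\|=1,\ \langle n,x-q\rangle\le 0\ \forall x\in C\}\subset\mathbb R^3\times\mathbb R^3$, oriented by the outer normal; for a finite union $\bigcup_i C_i$ of compact convex sets it is defined by inclusion–exclusion, $N(\bigcup_i C_i)=\sum_{\emptyset\ne s}(-1)^{|s|+1}N(\bigcap_{i\in s}C_i)$. At $(m,\xi)$ with $\|\xi\|=1$ let $(e_1,e_2,\xi)$ be a direct orthonormal basis, and put $\omega_1=(e_1,0)^*\wedge(0,e_2)^*+(0,e_1)^*\wedge(e_2,0)^*$ and $\omega_2=(0,e_1)^*\wedge(0,e_2)^*$, where $w^*=\langle w,\cdot\rangle$.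 The mean and Gaussian curvature measures of $K=\bigcup_iC_i$ are $\Phi^H_K(B)=\big(N(K)\llcorner(B\times\mathbb R^3)\big)(\omega_1)$ and $\Phi^G_K(B)=\big(N(K)\llcorner(B\times\mathbb R^3)\big)(\omega_2)$. Statement. For $K=\mathbb B_1\cup\mathbb B_2\cup\mathbb B_3$ the integrals defining $\Phi^H_K(\{p\})$ and $\Phi^G_K(\{p\})$ converge, $\Phi^H_K(\{p\})=0$, and $\Phi^G_K(\{p\})$ is the area of the spherical triangle of the unit sphere with vertices $(p-A_i)/r$, $i=1,2,3$: $$\Phi^G_K(\{p\})=4\arctan\sqrt{\tan\Big(\frac{\sigma}{2}\Big)\tan\Big(\frac{\sigma-\alpha_{1,2}}{2}\Big)\tan\Big(\frac{\sigma-\alpha_{2,3}}{2}\Big)\tan\Big(\frac{\sigma-\alpha_{1,3}}{2}\Big)},$$ where $$\alpha_{i,j}=\angle\big(\overrightarrow{pA_i},\overrightarrow{pA_j}\big)=2\arcsin\Big(\frac{A_iA_j}{2r}\Big),\qquad \sigma=\frac{\alpha_{1,2}+\alpha_{2,3}+\alpha_{3,1}}{2}.$$ -/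

import Mathlib

open MeasureTheory Topology Filter
open scoped RealInnerProductSpace

noncomputable section

namespace NormalCycle

/-- Euclidean three-space. -/
abbrev E3 : Type := EuclideanSpace ℝ (Fin 3)

/-- The tangent bundle `E × F` of `ℝ³`, with the product inner product
`⟨(e, f), (e', f')⟩ = ⟨e, e'⟩ + ⟨f, f'⟩`; points are pairs (base point, vector). -/
abbrev TE3 : Type := WithLp 2 (E3 × E3)

/-- The determinant of three vectors of `ℝ³` in the standard basis. -/
def det3 (u v w : E3) : ℝ := (EuclideanSpace.basisFun (Fin 3) ℝ).toBasis.det ![u, v, w]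

/-! ### Differential 2-forms on the tangent bundle -/

/-- The 1-form `x ↦ ⟨w, x⟩` attached to a vector `w` of the tangent bundle. -/
def dualForm (w : TE3) : TE3 →ₗ[ℝ] ℝ := innerₛₗ ℝ w

/-- The wedge product of two 1-forms:
`(f ∧ g) (x, y) = f x * g y - f y * g x`, see `wedge_apply`. -/
def wedge (f g : TE3 →ₗ[ℝ] ℝ) : TE3 [⋀^Fin 2]→ₗ[ℝ] ℝ :=
  (Matrix.detRowAlternating (n := Fin 2) (R := ℝ)).compLinearMap (LinearMap.pi ![f, g])

theorem wedge_apply (f g : TE3 →ₗ[ℝ] ℝ) (v : Fin 2 → TE3) :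
    wedge f g v = f (v 0) * g (v 1) - f (v 1) * g (v 0) := by
  refine (Matrix.det_fin_two (Matrix.of fun i j => LinearMap.pi ![f, g] (v i) j)).trans ?_
  simp [mul_comm]

/-- The horizontal vector `(e, 0)`. -/
def hor (e : E3) : TE3 := WithLp.toLp 2 (e, 0)

/-- The vertical vector `(0, e)`. -/
def ver (e : E3) : TE3 := WithLp.toLp 2 (0, e)

/-- `(e 0, e 1)` is an orthonormal frame of the plane orthogonal to the unit vector `ξ`, such that
`(e 0, e 1, ξ)` is a direct orthonormal basis. -/
def IsDirectFrame (ξ : E3) (e : Fin 2 → E3) : Prop :=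
  Orthonormal ℝ ![e 0, e 1, ξ] ∧ 0 < det3 (e 0) (e 1) ξ

/-- The coefficient of `t ^ k` in `(e₀* + t ε₀*) ∧ (e₁* + t ε₁*)`, where `eᵢ` also denotes the
horizontal vector `(eᵢ, 0)` and `εᵢ = (0, eᵢ)`. -/
def frameForm (e : Fin 2 → E3) : ℕ → TE3 [⋀^Fin 2]→ₗ[ℝ] ℝ
  | 0 => wedge (dualForm (hor (e 0))) (dualForm (hor (e 1)))
  | 1 => wedge (dualForm (hor (e 0))) (dualForm (ver (e 1)))
      + wedge (dualForm (ver (e 0))) (dualForm (hor (e 1)))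
  | 2 => wedge (dualForm (ver (e 0))) (dualForm (ver (e 1)))
  | _ => 0

theorem wedge_eq_sum_frameForm (e : Fin 2 → E3) (t : ℝ) :
    wedge (dualForm (hor (e 0)) + t • dualForm (ver (e 0)))
        (dualForm (hor (e 1)) + t • dualForm (ver (e 1)))
      = ∑ k ∈ Finset.range 3, t ^ k • frameForm e k := by
  ext v
  simp [Finset.sum_range_succ, frameForm, wedge_apply]
  ring

open Classical in
/-- The invariant 2-form `ω_k` at the point `(m, ξ)`, `‖ξ‖ = 1`, of the tangent bundle. It does not
depend on the frame that is used, see `invariantForm_eq`. -/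
def invariantForm (k : ℕ) (z : TE3) : TE3 [⋀^Fin 2]→ₗ[ℝ] ℝ :=
  if h : ∃ e, IsDirectFrame z.snd e then frameForm h.choose k else 0

/-! ### Unit normal bundles and their integration currents -/

/-- The outer unit normals of `C` at `p`. -/
def unitNormalCone (C : Set E3) (p : E3) : Set E3 :=
  {n | ‖n‖ = 1 ∧ ∀ x ∈ C, ⟪n, x - p⟫ ≤ 0}

/-- The unit normal bundle `{(p, n) | p ∈ ∂C, n an outer unit normal of C at p}` of a
convex set. -/
def unitNormalBundle (C : Set E3) : Set TE3 :=
  {z | z.fst ∈ frontier C ∧ z.snd ∈ unitNormalCone C z.fst}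

/-- `v` is a positively oriented orthonormal basis of the tangent plane of `S` at `z`: the set of
tangent vectors of `S` at `z` is the plane spanned by the orthonormal family `(v 0, v 1)`, and
the frame is mapped to the orientation defined by the outer normal `z.snd` under
`(m, ξ) ↦ m + t ξ`, for small `t > 0`. For the unit normal bundle `S` of a compact convex set (a
compact two-dimensional Lipschitz submanifold) there is such a basis at almost every point. -/
def IsOrientedTangentFrame (S : Set TE3) (z : TE3) (v : Fin 2 → TE3) : Prop :=
  Orthonormal ℝ v ∧
  posTangentConeAt S z = (Submodule.span ℝ (Set.range v) : Set TE3) ∧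
  ∀ᶠ t : ℝ in 𝓝[>] 0,
    0 < det3 ((v 0).fst + t • (v 0).snd) ((v 1).fst + t • (v 1).snd) z.snd

open Classical in
/-- The pairing `⟨τ(z), φ⟩` of an alternating form with the unit 2-vector `τ(z) = v₀ ∧ v₁` that
orients the tangent plane of `S` at `z` (and `0` at points without a tangent plane). It does not
depend on the basis, see `tangentPairing_eq`. -/
def tangentPairing (S : Set TE3) (z : TE3) (φ : TE3 [⋀^Fin 2]→ₗ[ℝ] ℝ) : ℝ :=
  if h : ∃ v, IsOrientedTangentFrame S z v then φ h.choose else 0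

/-- The normal cycle of a compact convex set `C`, restricted to `A` and applied to the form `ω`:
the integral over the part in `A` of the oriented unit normal bundle of `C`, with respect to the
two-dimensional Hausdorff measure (normalized to be the area). -/
def convexNormalCycle (C : Set E3) (A : Set TE3) (ω : TE3 → TE3 [⋀^Fin 2]→ₗ[ℝ] ℝ) : ℝ :=
  ∫ z in unitNormalBundle C ∩ A, tangentPairing (unitNormalBundle C) z (ω z) ∂μHE[2]

/-- The normal cycle of the union of a finite family of compact convex sets, defined by additivity
(inclusion-exclusion), restricted to `A` and applied to the form `ω`. -/
def unionNormalCycle {ι : Type*} [Fintype ι] (C : ι → Set E3) (A : Set TE3)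
    (ω : TE3 → TE3 [⋀^Fin 2]→ₗ[ℝ] ℝ) : ℝ :=
  ∑ s : Finset ι with s.Nonempty, (-1) ^ (s.card + 1) * convexNormalCycle (⋂ i ∈ s, C i) A ω

/-- The `k`-th curvature measure of the union of the finite family `C` of compact convex sets,
evaluated at `B ⊆ ℝ³`. -/
def curvatureMeasure {ι : Type*} [Fintype ι] (k : ℕ) (C : ι → Set E3) (B : Set E3) : ℝ :=
  unionNormalCycle C {z | z.fst ∈ B} (invariantForm k)

/-- All the integrals in the definition of `curvatureMeasure k C B` converge. -/
def CurvatureMeasureDefined {ι : Type*} (k : ℕ) (C : ι → Set E3) (B : Set E3) : Prop :=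
  ∀ s : Finset ι, s.Nonempty →
    IntegrableOn
      (fun z => tangentPairing (unitNormalBundle (⋂ i ∈ s, C i)) z (invariantForm k z))
      (unitNormalBundle (⋂ i ∈ s, C i) ∩ {z | z.fst ∈ B}) μHE[2]

/-- The mean curvature measure `Φ^H = Φ¹` (it integrates the trace of the Weingarten map). -/
abbrev meanCurvatureMeasure {ι : Type*} [Fintype ι] (C : ι → Set E3) (B : Set E3) : ℝ :=
  curvatureMeasure 1 C B

/-- The Gaussian curvature measure `Φ^G = Φ²`. -/
abbrev gaussianCurvatureMeasure {ι : Type*} [Fintype ι] (C : ι → Set E3) (B : Set E3) : ℝ :=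
  curvatureMeasure 2 C B

/-! ### General position and spherical triangles -/

/-- The balls of radius `r` with centers in `K` are in general position: no 4 points of `K` are
coplanar, no 5 are cospherical, and the smallest sphere through any 2, 3 or 4 of them does not have
radius `r`. -/
def InGeneralPosition (K : Set E3) (r : ℝ) : Prop :=
  (∀ T ⊆ K, T.ncard = 4 → ¬ Coplanar ℝ T) ∧
  (∀ T ⊆ K, T.ncard = 5 → ¬ EuclideanGeometry.Cospherical T) ∧
  ∀ T ⊆ K, 2 ≤ T.ncard → T.ncard ≤ 4 →
    ¬ IsLeast {ρ : ℝ | ∃ c : E3, ∀ x ∈ T, dist x c = ρ} r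

/-- The spherical triangle, on the unit sphere, whose vertices are the directions of the vectors
`u 0`, `u 1`, `u 2`: the unit vectors that are nonnegative combinations of them. -/
def sphericalTriangle (u : Fin 3 → E3) : Set E3 :=
  {ξ | ‖ξ‖ = 1 ∧ ∃ c : Fin 3 → ℝ, (∀ i, 0 ≤ c i) ∧ ξ = ∑ i, c i • u i}

/-! ### The definitions do not depend on the chosen frames -/

theorem det3_eq (u v w : E3) : det3 u v w =
    u 0 * (v 1 * w 2 - v 2 * w 1) - u 1 * (v 0 * w 2 - v 2 * w 0)
      + u 2 * (v 0 * w 1 - v 1 * w 0) := by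
  rw [det3, Module.Basis.det_apply, Matrix.det_fin_three]
  simp [Module.Basis.toMatrix_apply]
  ring

theorem tangentPairing_eq {S : Set TE3} {z : TE3} {v : Fin 2 → TE3}
    (hv : IsOrientedTangentFrame S z v) (φ : TE3 [⋀^Fin 2]→ₗ[ℝ] ℝ) :
    tangentPairing S z φ = φ v := by
  have h : ∃ v, IsOrientedTangentFrame S z v := ⟨v, hv⟩
  rw [tangentPairing, dif_pos h]
  obtain ⟨ho, hs, hd⟩ := hv
  obtain ⟨wo, ws, wd⟩ := h.choose_spec
  generalize h.choose = w at *
  have hmem : ∀ i, w i ∈ Submodule.span ℝ (Set.range v) := fun i => by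
    have : w i ∈ (Submodule.span ℝ (Set.range w) : Set TE3) :=
      Submodule.subset_span ⟨i, rfl⟩
    rw [← ws, hs] at this
    exact this
  have hr : Set.range v = {v 0, v 1} := by
    ext x; simp [Fin.exists_fin_two, eq_comm]
  rw [hr] at hmem
  obtain ⟨a, b, h0⟩ := Submodule.mem_span_pair.1 (hmem 0)
  obtain ⟨c, d, h1⟩ := Submodule.mem_span_pair.1 (hmem 1)
  have v00 : ⟪v 0, v 0⟫ = 1 := by simp [ho.1 0]
  have v11 : ⟪v 1, v 1⟫ = 1 := by simp [ho.1 1]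
  have v01 : ⟪v 0, v 1⟫ = 0 := ho.2 (by decide)
  have v10 : ⟪v 1, v 0⟫ = 0 := ho.2 (by decide)
  have w00 : ⟪w 0, w 0⟫ = 1 := by simp [wo.1 0]
  have w11 : ⟪w 1, w 1⟫ = 1 := by simp [wo.1 1]
  have w01 : ⟪w 0, w 1⟫ = 0 := wo.2 (by decide)
  rw [← h0] at w00 w01
  rw [← h1] at w11 w01
  simp only [inner_add_left, inner_add_right, real_inner_smul_left, real_inner_smul_right,
    v00, v11, v01, v10] at w00 w11 w01
  have hsq : (a * d - b * c) ^ 2 = 1 := by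
    have h2 : (a * d - b * c) ^ 2
        = (a * a + b * b) * (c * c + d * d) - (a * c + b * d) ^ 2 := by ring
    rw [h2, show a * a + b * b = 1 by linarith, show c * c + d * d = 1 by linarith,
      show a * c + b * d = 0 by linarith]
    norm_num
  obtain ⟨t, ht, ht'⟩ := (hd.and wd).exists
  have hdet : det3 ((w 0).fst + t • (w 0).snd) ((w 1).fst + t • (w 1).snd) z.snd
      = (a * d - b * c)
        * det3 ((v 0).fst + t • (v 0).snd) ((v 1).fst + t • (v 1).snd) z.snd := by
    rw [← h0, ← h1]
    simp only [det3_eq, WithLp.add_fst, WithLp.add_snd, WithLp.smul_fst, WithLp.smul_snd,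
      PiLp.add_apply, PiLp.smul_apply, smul_eq_mul]
    ring
  rw [hdet] at ht'
  have hpos : 0 < a * d - b * c := pos_of_mul_pos_left ht' ht.le
  have hone : a * d - b * c = 1 := by nlinarith
  have hw : w = ![a • v 0 + b • v 1, c • v 0 + d • v 1] := by
    ext1 i; fin_cases i <;> simp [h0, h1]
  have hvv : v = ![v 0, v 1] := by
    ext1 i; fin_cases i <;> simp
  have hz : ∀ x, φ ![x, x] = 0 := fun x =>
    φ.map_eq_zero_of_eq _ (i := 0) (j := 1) (by simp) (by decide)
  have hu0 : ∀ x y u : TE3, Function.update ![x, y] 0 u = ![u, y] := fun x y u => by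
    ext1 i; fin_cases i <;> simp
  have hu1 : ∀ x y u : TE3, Function.update ![x, y] 1 u = ![x, u] := fun x y u => by
    ext1 i; fin_cases i <;> simp
  have hadd : ∀ x x' y, φ ![x + x', y] = φ ![x, y] + φ ![x', y] := fun x x' y => by
    have h3 := φ.map_update_add ![x, y] 0 x x'
    rwa [hu0, hu0, hu0] at h3
  have hsmul : ∀ (r : ℝ) x y, φ ![r • x, y] = r * φ ![x, y] := fun r x y => by
    have h3 := φ.map_update_smul ![x, y] 0 r x
    rwa [hu0, hu0] at h3
  have hswap : ∀ x y, φ ![x, y] = - φ ![y, x] := fun x y => by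
    have := hz (x + y)
    rw [hadd] at this
    have e : ∀ u, φ ![u, x + y] = φ ![u, x] + φ ![u, y] := fun u => by
      have h3 := φ.map_update_add ![u, x] 1 x y
      rwa [hu1, hu1, hu1] at h3
    rw [e, e, hz, hz] at this
    linarith
  have key : φ w = (a * d - b * c) * φ v := by
    rw [hw, hvv]
    simp only [Matrix.cons_val_zero, Matrix.cons_val_one]
    rw [hadd, hsmul, hsmul, hswap (v 0), hswap (v 1), hadd, hadd, hsmul, hsmul, hsmul, hsmul,
      hz, hz, hswap (v 1) (v 0)]
    ring
  rw [key, hone, one_mul]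

theorem det3_mul_det3 (u v w x y z : E3) : det3 u v w * det3 x y z =
    ⟪u, x⟫ * (⟪v, y⟫ * ⟪w, z⟫ - ⟪v, z⟫ * ⟪w, y⟫)
      - ⟪u, y⟫ * (⟪v, x⟫ * ⟪w, z⟫ - ⟪v, z⟫ * ⟪w, x⟫)
      + ⟪u, z⟫ * (⟪v, x⟫ * ⟪w, y⟫ - ⟪v, y⟫ * ⟪w, x⟫) := by
  simp only [det3_eq, PiLp.inner_apply, Fin.sum_univ_three, RCLike.inner_apply, conj_trivial]
  ring

theorem det3_eq_of_isDirectFrame {ξ : E3} {e : Fin 2 → E3} (he : IsDirectFrame ξ e) (x y : E3) :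
    det3 x y ξ = ⟪e 0, x⟫ * ⟪e 1, y⟫ - ⟪e 0, y⟫ * ⟪e 1, x⟫ := by
  obtain ⟨ho, hd⟩ := he
  have h00 : ⟪e 0, e 0⟫ = 1 := by
    rw [real_inner_self_eq_norm_sq, show ‖e 0‖ = 1 by simpa using ho.1 0, one_pow]
  have h11 : ⟪e 1, e 1⟫ = 1 := by
    rw [real_inner_self_eq_norm_sq, show ‖e 1‖ = 1 by simpa using ho.1 1, one_pow]
  have h22 : ⟪ξ, ξ⟫ = 1 := by
    rw [real_inner_self_eq_norm_sq, show ‖ξ‖ = 1 by simpa using ho.1 2, one_pow]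
  have h01 : ⟪e 0, e 1⟫ = 0 := by simpa using ho.2 (show (0 : Fin 3) ≠ 1 by decide)
  have h02 : ⟪e 0, ξ⟫ = 0 := by simpa using ho.2 (show (0 : Fin 3) ≠ 2 by decide)
  have h12 : ⟪e 1, ξ⟫ = 0 := by simpa using ho.2 (show (1 : Fin 3) ≠ 2 by decide)
  have h1 := det3_mul_det3 (e 0) (e 1) ξ (e 0) (e 1) ξ
  have h2 := det3_mul_det3 (e 0) (e 1) ξ x y ξ
  rw [h00, h11, h22, h01, h02, h12] at h1
  rw [h22, h02, h12] at h2
  have hone : det3 (e 0) (e 1) ξ = 1 := by nlinarith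
  rw [hone] at h2
  linarith

theorem invariantForm_eq {k : ℕ} {z : TE3} {e : Fin 2 → E3} (he : IsDirectFrame z.snd e) :
    invariantForm k z = frameForm e k := by
  have h : ∃ e, IsDirectFrame z.snd e := ⟨e, he⟩
  rw [invariantForm, dif_pos h]
  have he' := h.choose_spec
  generalize h.choose = f at *
  have key : ∀ x y : E3, ⟪f 0, x⟫ * ⟪f 1, y⟫ - ⟪f 0, y⟫ * ⟪f 1, x⟫
      = ⟪e 0, x⟫ * ⟪e 1, y⟫ - ⟪e 0, y⟫ * ⟪e 1, x⟫ := fun x y => by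
    rw [← det3_eq_of_isDirectFrame he, ← det3_eq_of_isDirectFrame he']
  ext v
  match k with
  | 0 =>
    simpa [frameForm, wedge_apply, dualForm, hor, WithLp.prod_inner_apply] using
      key (v 0).fst (v 1).fst
  | 1 =>
    have h1 := key (v 0).fst (v 1).snd
    have h2 := key (v 0).snd (v 1).fst
    simp [frameForm, wedge_apply, dualForm, hor, ver, WithLp.prod_inner_apply]
    linarith
  | 2 =>
    simpa [frameForm, wedge_apply, dualForm, ver, WithLp.prod_inner_apply] using
      key (v 0).snd (v 1).snd
  | k + 3 => rfl

end NormalCycle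

end

/-! Over `{p}` the unit normal bundle of an intersection of balls is the set of unit outer normals
at `p`. If at most two distinct balls are involved, these normals lie in a plane: general position
excludes antipodal vectors `p - A i`, so the balls have a common strictly inward direction and every
vector orthogonal to the `p - A i` is orthogonal to the normals. Such a fiber lies in a great circle
and is null (`hausdorff_fiber_pair`).

With three distinct centers, general position makes the `p - A i` linearly independent
(`InGeneralPosition.det3_ne_zero`), and polar duality identifies the fiber of the triple
intersection with the spherical triangle they span (`unitNormalCone_eq_sphericalTriangle`). In the
inclusion–exclusion sum only this term survives, with sign `+1`. Off the edges of the triangle the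
bundle is locally the vertical sphere over `p` (`unitNormalBundle_eventuallyEq`), oriented by
vertical lifts of direct frames. On these the mean curvature form is `0` and the Gaussian form is
`1`, so the measures are `0` and the area of the triangle. If two centers coincide, everything is
null and one factor of the formula vanishes.

The area rests on Girard's theorem (`hausdorff_triangle`), hence on the areas of the sphere and of
lunes. These are found for Hausdorff measure by double counting with Fubini and invariance under
isometries. The spherical law of cosines then turns the angular excess into L'Huilier's expression
in the sides (`eq_four_mul_arctan`). -/

namespace NormalCycle

open InnerProductGeometry

/-! ### Hausdorff measure on the unit sphere -/

theorem exists_linearIsometryEquiv_apply_eq {x y : E3} (h : ‖x‖ = ‖y‖) :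
    ∃ Φ : E3 ≃ₗᵢ[ℝ] E3, Φ x = y :=
  ⟨_, Submodule.reflection_sub h⟩

theorem hausdorff_preimage (Φ : E3 ≃ₗᵢ[ℝ] E3) (s : Set E3) : μHE[2] (Φ ⁻¹' s) = μHE[2] s := by
  rw [Φ.isometry.euclideanHausdorffMeasure_preimage, Φ.surjective.range_eq, Set.inter_univ]

theorem inner_eq (x y : E3) : ⟪x, y⟫ = x 0 * y 0 + x 1 * y 1 + x 2 * y 2 := by
  simp only [PiLp.inner_apply, Fin.sum_univ_three, RCLike.inner_apply, conj_trivial]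
  ring

theorem norm_sq_eq (x : E3) : ‖x‖ ^ 2 = x 0 ^ 2 + x 1 ^ 2 + x 2 ^ 2 := by
  rw [← real_inner_self_eq_norm_sq, inner_eq]
  ring

theorem mem_sphere_iff (x : E3) :
    x ∈ Metric.sphere (0 : E3) 1 ↔ x 0 ^ 2 + x 1 ^ 2 + x 2 ^ 2 = 1 := by
  rw [mem_sphere_zero_iff_norm, ← norm_sq_eq]
  constructor
  · intro h; rw [h]; norm_num
  · intro h
    exact (pow_eq_one_iff_of_nonneg (norm_nonneg x) two_ne_zero).1 h

/-- The north pole. -/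
noncomputable def pole : E3 := EuclideanSpace.single 2 1

theorem inner_pole (x : E3) : ⟪pole, x⟫ = x 2 := by
  simp [pole, inner_eq]

theorem norm_pole : ‖pole‖ = 1 := by simp [pole]

theorem exists_cos_sin_eq {x y : ℝ} (h : x ^ 2 + y ^ 2 = 1) :
    ∃ t, x = Real.cos t ∧ y = Real.sin t := by
  have hn : ‖(⟨x, y⟩ : ℂ)‖ = 1 := by
    rw [Complex.norm_def, Complex.normSq_mk, ← sq, ← sq, h, Real.sqrt_one]
  refine ⟨Complex.arg ⟨x, y⟩, ?_, ?_⟩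
  · have := Complex.norm_mul_cos_arg ⟨x, y⟩
    rw [hn, one_mul] at this
    exact this.symm
  · have := Complex.norm_mul_sin_arg ⟨x, y⟩
    rw [hn, one_mul] at this
    exact this.symm

/-- The equator is the image of a smooth curve, so its Hausdorff dimension is at most 1. -/
theorem hausdorff_equator : μHE[2] {ξ : E3 | ‖ξ‖ = 1 ∧ ξ 2 = 0} = 0 := by
  let f : ℝ → E3 := fun t => !₂[Real.cos t, Real.sin t, 0]
  have hf : ContDiff ℝ 1 f := by
    rw [contDiff_euclidean]
    intro i
    fin_cases i
    · exact Real.contDiff_cos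
    · exact Real.contDiff_sin
    · exact contDiff_const
  have hd : dimH (Set.range f) < ((2 : NNReal) : ENNReal) := by
    refine hf.dimH_range_le.trans_lt ?_
    norm_num
  have h0 : μHE[2] (Set.range f) = 0 := by
    have := hausdorffMeasure_of_dimH_lt hd
    -- `μHE[2]` is a constant multiple of the usual Hausdorff measure, so nullity passes over.
    rw [Measure.euclideanHausdorffMeasure_def, Measure.smul_apply]
    norm_num at this ⊢
    simp [this]
  refine measure_mono_null ?_ h0
  rintro ξ ⟨h1, h2⟩
  have := norm_sq_eq ξ
  rw [h1, h2] at this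
  obtain ⟨t, hc, hs⟩ := exists_cos_sin_eq (x := ξ 0) (y := ξ 1) (by linarith)
  refine ⟨t, ?_⟩
  ext i
  fin_cases i
  · simp [f, hc]
  · simp [f, hs]
  · simp [f, h2]

theorem hausdorff_great_circle {w : E3} (hw : w ≠ 0) :
    μHE[2] {ξ : E3 | ‖ξ‖ = 1 ∧ ⟪w, ξ⟫ = 0} = 0 := by
  obtain ⟨Φ, hΦ⟩ := exists_linearIsometryEquiv_apply_eq (x := w) (y := ‖w‖ • pole)
    (by simp [norm_smul, norm_pole])
  rw [← hausdorff_equator, ← hausdorff_preimage Φ {ξ | ‖ξ‖ = 1 ∧ ξ 2 = 0}]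
  congr 1
  ext ξ
  simp only [Set.mem_ofPred_eq, Set.mem_preimage, LinearIsometryEquiv.norm_map]
  rw [← inner_pole, ← LinearIsometryEquiv.inner_map_map Φ w ξ, hΦ, real_inner_smul_left]
  simp [hw]

/-! ### Area of spherical caps -/

/-- The orthogonal projection to the equatorial plane. -/
noncomputable def equatorialProj (x : E3) : EuclideanSpace ℝ (Fin 2) := !₂[x 0, x 1]

theorem dist_sq_eq (x y : E3) :
    dist x y ^ 2 = dist (equatorialProj x) (equatorialProj y) ^ 2 + (x 2 - y 2) ^ 2 := by
  rw [EuclideanSpace.dist_sq_eq, EuclideanSpace.dist_sq_eq, Fin.sum_univ_three, Fin.sum_univ_two]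
  simp [equatorialProj, Real.dist_eq, sq_abs]

/-- The open spherical cap around the north pole cut out by a plane of height `k`. -/
def cap (k : ℝ) : Set E3 := {ξ | ‖ξ‖ = 1 ∧ k < ξ 2}

theorem image_cap {k : ℝ} (hk : 0 < k) :
    equatorialProj '' cap k = Metric.ball 0 √(1 - k ^ 2) := by
  ext y
  rw [mem_ball_zero_iff, EuclideanSpace.norm_eq, Fin.sum_univ_two]
  simp only [Real.norm_eq_abs, sq_abs]
  rw [Real.sqrt_lt_sqrt_iff (by positivity)]
  constructor
  · rintro ⟨x, ⟨h1, h2⟩, rfl⟩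
    have := norm_sq_eq x
    rw [h1] at this
    simp only [equatorialProj, PiLp.toLp_apply, Matrix.cons_val_zero, Matrix.cons_val_one]
    nlinarith
  · intro h
    have h0 : 0 ≤ 1 - y 0 ^ 2 - y 1 ^ 2 := by nlinarith
    refine ⟨!₂[y 0, y 1, √(1 - y 0 ^ 2 - y 1 ^ 2)], ⟨?_, ?_⟩, ?_⟩
    · rw [← mem_sphere_zero_iff_norm, mem_sphere_iff]
      simp [Real.sq_sqrt h0]
    · simp only [Matrix.cons_val]
      apply Real.lt_sqrt_of_sq_lt
      linarith
    · ext i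
      fin_cases i <;> simp [equatorialProj]

theorem volume_ball_two {k : ℝ} (hk : 0 < k) (hk1 : k < 1) :
    volume (Metric.ball (0 : EuclideanSpace ℝ (Fin 2)) √(1 - k ^ 2))
      = ENNReal.ofReal (Real.pi * (1 - k ^ 2)) := by
  rw [EuclideanSpace.volume_ball_fin_two, ← ENNReal.ofReal_pow (Real.sqrt_nonneg _),
    Real.sq_sqrt (by nlinarith), mul_comm, ENNReal.ofReal_mul Real.pi_pos.le]

/-- The projection to the equatorial plane is 1-Lipschitz, so it cannot increase area; its image is
a disc, where Hausdorff measure is Lebesgue measure. -/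
theorem le_hausdorff_cap {k : ℝ} (hk : 0 < k) (hk1 : k < 1) :
    ENNReal.ofReal (Real.pi * (1 - k ^ 2)) ≤ μHE[2] (cap k) := by
  have hl : LipschitzWith 1 equatorialProj := by
    refine LipschitzWith.of_dist_le_mul fun x y => ?_
    rw [NNReal.coe_one, one_mul]
    refine abs_le_of_sq_le_sq' ?_ dist_nonneg |>.2
    rw [dist_sq_eq]
    nlinarith [sq_nonneg (x 2 - y 2)]
  rw [← volume_ball_two hk hk1, ← image_cap hk,
    ← EuclideanSpace.euclideanHausdorffMeasure_eq_volume]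
  simp_rw [Measure.euclideanHausdorffMeasure_def, Measure.smul_apply]
  have := hl.hausdorffMeasure_image_le (d := 2) (by norm_num) (cap k)
  gcongr
  simpa using this

/-- On the sphere, `(x 2 - y 2) * (x 2 + y 2)` is minus the product of the horizontal difference and
the horizontal sum. Cauchy–Schwarz, with vertical sum at least `2 k` and squared horizontal sum at
most `4 (1 - k ^ 2)`, bounds the slope; then `1 + (1 - k ^ 2) / k ^ 2 = k⁻¹ ^ 2`. -/
theorem dist_le_of_mem_cap {k : ℝ} (hk : 0 < k) {x y : E3} (hx : x ∈ cap k) (hy : y ∈ cap k) :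
    dist x y ≤ k⁻¹ * dist (equatorialProj x) (equatorialProj y) := by
  obtain ⟨hx1, hx2⟩ := hx
  obtain ⟨hy1, hy2⟩ := hy
  have ex := norm_sq_eq x
  have ey := norm_sq_eq y
  rw [hx1] at ex
  rw [hy1] at ey
  refine abs_le_of_sq_le_sq' ?_ (by positivity) |>.2
  rw [dist_sq_eq, mul_pow]
  have hD : dist (equatorialProj x) (equatorialProj y) ^ 2
      = (x 0 - y 0) ^ 2 + (x 1 - y 1) ^ 2 := by
    rw [EuclideanSpace.dist_sq_eq, Fin.sum_univ_two]
    simp [equatorialProj, Real.dist_eq, sq_abs]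
  rw [hD]
  set D := (x 0 - y 0) ^ 2 + (x 1 - y 1) ^ 2
  have hD0 : 0 ≤ D := by positivity
  have h1 : ((x 2 - y 2) * (x 2 + y 2)) ^ 2
      ≤ D * ((x 0 + y 0) ^ 2 + (x 1 + y 1) ^ 2) := by
    have : (x 2 - y 2) * (x 2 + y 2)
        = -((x 0 - y 0) * (x 0 + y 0) + (x 1 - y 1) * (x 1 + y 1)) := by linarith
    rw [this]
    nlinarith [sq_nonneg ((x 0 - y 0) * (x 1 + y 1) - (x 1 - y 1) * (x 0 + y 0))]
  have h2 : (x 0 + y 0) ^ 2 + (x 1 + y 1) ^ 2 ≤ 4 * (1 - k ^ 2) := by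
    nlinarith [sq_nonneg (x 0 - y 0), sq_nonneg (x 1 - y 1)]
  have h3 : (x 2 - y 2) ^ 2 * (4 * k ^ 2) ≤ D * (4 * (1 - k ^ 2)) := by
    calc (x 2 - y 2) ^ 2 * (4 * k ^ 2) ≤ (x 2 - y 2) ^ 2 * (x 2 + y 2) ^ 2 := by
          gcongr; nlinarith
      _ ≤ _ := by rw [← mul_pow]; exact h1.trans (by gcongr)
  rw [inv_pow, ← div_eq_inv_mul, le_div_iff₀ (by positivity)]
  nlinarith

/-- The inverse of the projection is `k⁻¹`-Lipschitz on the disc, so it multiplies area by at most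
`k⁻¹ ^ 2`. This matches the lower bound to leading order as `k → 1`. -/
theorem hausdorff_cap_le {k : ℝ} (hk : 0 < k) (hk1 : k < 1) :
    μHE[2] (cap k) ≤ ENNReal.ofReal (Real.pi * (1 - k ^ 2) / k ^ 2) := by
  have hinj : Set.InjOn equatorialProj (cap k) := fun x hx y hy h => by
    have := dist_le_of_mem_cap hk hx hy
    rw [h, dist_self, mul_zero] at this
    exact dist_le_zero.1 this
  let g := Function.invFunOn equatorialProj (cap k)
  have hg : ∀ x ∈ cap k, g (equatorialProj x) = x := fun x hx =>
    hinj.leftInvOn_invFunOn hx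
  have hl : LipschitzOnWith (Real.toNNReal k⁻¹) g (equatorialProj '' cap k) := by
    refine LipschitzOnWith.of_dist_le_mul ?_
    rintro _ ⟨x, hx, rfl⟩ _ ⟨y, hy, rfl⟩
    rw [hg x hx, hg y hy, Real.coe_toNNReal _ (by positivity)]
    exact dist_le_of_mem_cap hk hx hy
  have himg : g '' (equatorialProj '' cap k) = cap k := by
    rw [Set.image_image]
    ext x
    constructor
    · rintro ⟨y, hy, rfl⟩
      simpa only [hg y hy] using hy
    · exact fun hx => ⟨x, hx, hg x hx⟩
  have h1 := hl.hausdorffMeasure_image_le (d := 2) (by norm_num)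
  rw [himg] at h1
  have h2 : (μHE[2] : Measure (EuclideanSpace ℝ (Fin 2))) (equatorialProj '' cap k)
      = ENNReal.ofReal (Real.pi * (1 - k ^ 2)) := by
    rw [EuclideanSpace.euclideanHausdorffMeasure_eq_volume, image_cap hk,
      volume_ball_two hk hk1]
  have h3 : ENNReal.ofReal (Real.pi * (1 - k ^ 2) / k ^ 2)
      = ENNReal.ofReal (k⁻¹) ^ 2 * ENNReal.ofReal (Real.pi * (1 - k ^ 2)) := by
    rw [← ENNReal.ofReal_pow (by positivity), ← ENNReal.ofReal_mul (by positivity)]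
    congr 1
    field_simp
  rw [h3, ← h2]
  simp_rw [Measure.euclideanHausdorffMeasure_def, Measure.smul_apply]
  rw [mul_smul_comm]
  gcongr
  simpa using! h1

theorem measurableSet_sphere : MeasurableSet (Metric.sphere (0 : E3) 1) :=
  Metric.isClosed_sphere.measurableSet

/-- By compactness a local bound suffices, and a rotated cap is a neighbourhood of finite area. -/
theorem hausdorff_sphere_lt_top : μHE[2] (Metric.sphere (0 : E3) 1) < ⊤ := by
  refine (isCompact_sphere (0 : E3) 1).measure_lt_top_of_nhdsWithin fun x hx => ?_
  obtain ⟨Φ, hΦ⟩ := exists_linearIsometryEquiv_apply_eq (x := x) (y := pole)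
    (by rw [norm_pole]; exact mem_sphere_zero_iff_norm.1 hx)
  refine ⟨Φ ⁻¹' (cap (1 / 2)), ?_, ?_⟩
  · have ho : IsOpen {y : E3 | 1 / 2 < (Φ y) 2} :=
      isOpen_lt continuous_const (by fun_prop)
    refine mem_nhdsWithin.2 ⟨_, ho, ?_, ?_⟩
    · simp only [Set.mem_ofPred_eq, hΦ]
      norm_num [pole]
    · rintro y ⟨h1, h2⟩
      refine ⟨?_, h1⟩
      rw [LinearIsometryEquiv.norm_map]
      exact mem_sphere_zero_iff_norm.1 h2
  · rw [hausdorff_preimage]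
    exact (hausdorff_cap_le (by norm_num) (by norm_num)).trans_lt ENNReal.ofReal_lt_top

/-! ### Area of the unit sphere -/

theorem measurePreserving_height_equatorialProj :
    MeasurePreserving (fun x : E3 => (x 2, equatorialProj x))
      volume (volume.prod volume) := by
  have h1 := EuclideanSpace.volume_preserving_symm_measurableEquiv_toLp (Fin 3)
  have h2 := volume_preserving_piFinSuccAbove (fun _ : Fin 3 => ℝ) 2
  have h3 := (EuclideanSpace.volume_preserving_symm_measurableEquiv_toLp (Fin 2)).symm
  have h4 := (MeasurePreserving.id (volume : Measure ℝ)).prod h3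
  have h5 := (h4.comp h2).comp h1
  refine (congrArg (fun f => MeasurePreserving f volume (volume.prod volume)) ?_).mp h5
  funext x
  refine Prod.ext rfl ?_
  ext i
  fin_cases i <;> rfl

/-- The slice at height `z` is a disc of area `π c z ^ 2`. -/
theorem volume_cone {c h : ℝ} (hc : 0 < c) (hh : 0 < h) :
    volume {x : E3 | 0 < x 2 ∧ x 2 < h ∧ x 0 ^ 2 + x 1 ^ 2 < c * x 2 ^ 2}
      = ENNReal.ofReal (Real.pi * c * h ^ 3 / 3) := by
  let Q : Set (ℝ × EuclideanSpace ℝ (Fin 2)) :=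
    {q | 0 < q.1 ∧ q.1 < h ∧ q.2 0 ^ 2 + q.2 1 ^ 2 < c * q.1 ^ 2}
  have hQ : MeasurableSet Q := by
    have o1 : IsOpen {q : ℝ × EuclideanSpace ℝ (Fin 2) | q.2 0 ^ 2 + q.2 1 ^ 2 < c * q.1 ^ 2} :=
      isOpen_lt (by fun_prop) (by fun_prop)
    exact ((isOpen_lt continuous_const continuous_fst).inter
      ((isOpen_lt continuous_fst continuous_const).inter o1)).measurableSet
  have h1 := measurePreserving_height_equatorialProj.measure_preimage hQ.nullMeasurableSet
  have h2 : (fun x : E3 => (x 2, equatorialProj x)) ⁻¹' Q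
      = {x : E3 | 0 < x 2 ∧ x 2 < h ∧ x 0 ^ 2 + x 1 ^ 2 < c * x 2 ^ 2} := by
    ext x
    simp [Q, equatorialProj]
  rw [← h2, h1, Measure.prod_apply hQ]
  have h3 : ∀ z : ℝ, volume (Prod.mk z ⁻¹' Q)
      = (Set.Ioo 0 h).indicator (fun z => ENNReal.ofReal (Real.pi * c * z ^ 2)) z := by
    intro z
    by_cases hz : z ∈ Set.Ioo 0 h
    · rw [Set.indicator_of_mem hz]
      have : Prod.mk z ⁻¹' Q = Metric.ball (0 : EuclideanSpace ℝ (Fin 2)) √(c * z ^ 2) := by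
        ext y
        rw [mem_ball_zero_iff, EuclideanSpace.norm_eq, Fin.sum_univ_two]
        simp only [Real.norm_eq_abs, sq_abs]
        rw [Real.sqrt_lt_sqrt_iff (by positivity)]
        exact ⟨fun h => h.2.2, fun h => ⟨hz.1, hz.2, h⟩⟩
      rw [this, EuclideanSpace.volume_ball_fin_two, ← ENNReal.ofReal_pow (Real.sqrt_nonneg _),
        Real.sq_sqrt (by positivity), mul_comm, mul_assoc, ENNReal.ofReal_mul Real.pi_pos.le]
    · rw [Set.indicator_of_notMem hz]
      have : Prod.mk z ⁻¹' Q = ∅ := by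
        ext y
        simp only [Set.mem_preimage, Set.mem_empty_iff_false, iff_false]
        exact fun h => hz ⟨h.1, h.2.1⟩
      rw [this, measure_empty]
  simp_rw [h3]
  rw [lintegral_indicator measurableSet_Ioo, ← ofReal_integral_eq_lintegral_ofReal,
    ← integral_Ioc_eq_integral_Ioo, ← intervalIntegral.integral_of_le hh.le,
    intervalIntegral.integral_const_mul, integral_pow]
  · congr 1
    norm_num
    ring
  · exact ((continuous_const.mul (continuous_pow 2)).integrableOn_Icc).mono_set
      Set.Ioo_subset_Icc_self
  · exact Eventually.of_forall fun z => by positivity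

/-- The solid cone over `cap k` in the unit ball. -/
def solidCone (k : ℝ) : Set E3 := {x | ‖x‖ < 1 ∧ k * ‖x‖ < x 2}

/-- The condition `k * ‖x‖ < x 2` describes a straight cone of squared slope `(1 - k ^ 2) / k ^ 2`.
The unit ball cuts it below height `1`; conversely, cutting it at height `k` keeps it inside the
ball, which gives the lower bound. -/
theorem volume_solidCone_le {k : ℝ} (hk : 0 < k) (hk1 : k < 1) :
    volume (solidCone k) ≤ ENNReal.ofReal (Real.pi * (1 - k ^ 2) / k ^ 2 / 3) := by
  have hc : 0 < (1 - k ^ 2) / k ^ 2 := div_pos (by nlinarith) (by positivity)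
  refine (measure_mono ?_).trans (volume_cone hc one_pos).le |>.trans_eq ?_
  · rintro x ⟨h1, h2⟩
    have hn := norm_sq_eq x
    have h0 : 0 < x 2 := lt_of_le_of_lt (by positivity) h2
    refine ⟨h0, ?_, ?_⟩
    · nlinarith [norm_nonneg x, sq_nonneg (x 0), sq_nonneg (x 1)]
    · have : (k * ‖x‖) ^ 2 < x 2 ^ 2 := by
        gcongr
      rw [div_mul_eq_mul_div, lt_div_iff₀ (by positivity)]
      nlinarith
  · congr 1
    ring

theorem le_volume_solidCone {k : ℝ} (hk : 0 < k) (hk1 : k < 1) :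
    ENNReal.ofReal (Real.pi * (1 - k ^ 2) * k / 3) ≤ volume (solidCone k) := by
  have hc : 0 < (1 - k ^ 2) / k ^ 2 := div_pos (by nlinarith) (by positivity)
  refine Eq.trans_le ?_ ((volume_cone hc hk).ge.trans (measure_mono ?_))
  · congr 1
    field_simp
  · rintro x ⟨h0, h1, h2⟩
    have hn := norm_sq_eq x
    rw [div_mul_eq_mul_div, lt_div_iff₀ (by positivity)] at h2
    have h3 : k * ‖x‖ < x 2 := by
      refine lt_of_pow_lt_pow_left₀ 2 h0.le ?_
      nlinarith
    exact ⟨by nlinarith, h3⟩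

theorem volume_preimage (Φ : E3 ≃ₗᵢ[ℝ] E3) {s : Set E3} (hs : MeasurableSet s) :
    volume (Φ ⁻¹' s) = volume s :=
  Φ.measurePreserving.measure_preimage hs.nullMeasurableSet

theorem measurableSet_solidCone (k : ℝ) : MeasurableSet (solidCone k) := by
  have o1 : IsOpen {x : E3 | k * ‖x‖ < x 2} := isOpen_lt (by fun_prop) (by fun_prop)
  exact ((isOpen_lt continuous_norm continuous_const).inter o1).measurableSet

/-- Double counting of the pairs `(x, ξ)` in ball times sphere whose directions have inner product
above `k`. For fixed `x ≠ 0` the `ξ` form a rotated cap, for fixed `ξ` the `x` form a rotated solid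
cone. This relates area to volume without a parametrization. -/
theorem volume_ball_mul_hausdorff_cap (k : ℝ) :
    volume (Metric.ball (0 : E3) 1) * μHE[2] (cap k)
      = volume (solidCone k) * μHE[2] (Metric.sphere (0 : E3) 1) := by
  let ν : Measure E3 := μHE[2].restrict (Metric.sphere 0 1)
  let lam : Measure E3 := volume.restrict (Metric.ball 0 1)
  have : IsFiniteMeasure ν := ⟨by simpa [ν] using hausdorff_sphere_lt_top⟩
  let Q : Set (E3 × E3) := {q | k * ‖q.1‖ < ⟪q.1, q.2⟫}
  have hQ : MeasurableSet Q := (isOpen_lt (by fun_prop) (by fun_prop)).measurableSet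
  have h1 := Measure.prod_apply (μ := lam) (ν := ν) hQ
  have h2 := Measure.prod_apply_symm (μ := lam) (ν := ν) hQ
  have e1 : ∀ᵐ x ∂lam, ν (Prod.mk x ⁻¹' Q) = μHE[2] (cap k) := by
    have : ∀ᵐ x ∂lam, x ≠ 0 := ae_restrict_of_ae (by simp [ae_iff])
    filter_upwards [this] with x hx
    have hx0 : 0 < ‖x‖ := norm_pos_iff.2 hx
    obtain ⟨Φ, hΦ⟩ := exists_linearIsometryEquiv_apply_eq (x := x) (y := ‖x‖ • pole)
      (by simp [norm_smul, norm_pole])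
    rw [← hausdorff_preimage Φ (cap k), Measure.restrict_apply (hQ.preimage (by fun_prop))]
    congr 1
    ext ξ
    simp only [Q, cap, Set.mem_inter_iff, Set.mem_preimage, Set.mem_ofPred_eq,
      mem_sphere_zero_iff_norm, LinearIsometryEquiv.norm_map]
    rw [← inner_pole, ← Φ.inner_map_map x ξ, hΦ, real_inner_smul_left, mul_comm k,
      mul_lt_mul_iff_right₀ hx0, and_comm]
  have e2 : ∀ᵐ ξ ∂ν, lam ((fun x => (x, ξ)) ⁻¹' Q) = volume (solidCone k) := by
    filter_upwards [ae_restrict_mem measurableSet_sphere] with ξ hξ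
    obtain ⟨Φ, hΦ⟩ := exists_linearIsometryEquiv_apply_eq (x := ξ) (y := pole)
      (by rw [norm_pole]; exact mem_sphere_zero_iff_norm.1 hξ)
    rw [← volume_preimage Φ (measurableSet_solidCone k),
      Measure.restrict_apply (hQ.preimage (by fun_prop))]
    congr 1
    ext x
    simp only [Q, solidCone, Set.mem_inter_iff, Set.mem_preimage, Set.mem_ofPred_eq,
      mem_ball_zero_iff, LinearIsometryEquiv.norm_map]
    rw [← inner_pole, ← Φ.inner_map_map x ξ, hΦ, real_inner_comm, and_comm]
  rw [h1, lintegral_congr_ae e1, lintegral_congr_ae e2, lintegral_const, lintegral_const] at h2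
  simp only [ν, lam, Measure.restrict_apply_univ] at h2
  rw [mul_comm, h2]

/-- In the double-counting identity the factor `1 - k ^ 2` of the cap and cone bounds cancels; the
remaining bounds pinch as `k → 1` from below. -/
theorem hausdorff_sphere :
    (μHE[2] : Measure E3).real (Metric.sphere (0 : E3) 1) = 4 * Real.pi := by
  have hpi := Real.pi_pos
  have key : ∀ k : ℝ, 0 < k → k < 1 →
      4 * Real.pi * k ^ 2 ≤ (μHE[2] : Measure E3).real (Metric.sphere (0 : E3) 1) ∧
      (μHE[2] : Measure E3).real (Metric.sphere (0 : E3) 1) ≤ 4 * Real.pi / k ^ 3 := by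
    intro k hk hk1
    have hk2 : 0 < 1 - k ^ 2 := by nlinarith
    have h := congrArg ENNReal.toReal (volume_ball_mul_hausdorff_cap k)
    rw [ENNReal.toReal_mul, ENNReal.toReal_mul, EuclideanSpace.volume_ball_fin_three] at h
    have hb : (ENNReal.ofReal 1 ^ 3 * ENNReal.ofReal (Real.pi * 4 / 3)).toReal
        = Real.pi * 4 / 3 := by
      rw [ENNReal.ofReal_one, one_pow, one_mul, ENNReal.toReal_ofReal (by positivity)]
    rw [hb] at h
    have c1 := ENNReal.toReal_mono ((hausdorff_cap_le hk hk1).trans_lt ENNReal.ofReal_lt_top).ne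
      (le_hausdorff_cap hk hk1)
    have c2 := ENNReal.toReal_mono ENNReal.ofReal_ne_top (hausdorff_cap_le hk hk1)
    have v1 := ENNReal.toReal_mono
      ((volume_solidCone_le hk hk1).trans_lt ENNReal.ofReal_lt_top).ne (le_volume_solidCone hk hk1)
    have v2 := ENNReal.toReal_mono ENNReal.ofReal_ne_top (volume_solidCone_le hk hk1)
    rw [ENNReal.toReal_ofReal (by positivity)] at c1 c2 v1 v2
    rw [measureReal_def]
    set a := (μHE[2] (Metric.sphere (0 : E3) 1)).toReal
    have ha : 0 ≤ a := ENNReal.toReal_nonneg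
    constructor
    · have : Real.pi * 4 / 3 * (Real.pi * (1 - k ^ 2))
          ≤ Real.pi * (1 - k ^ 2) / k ^ 2 / 3 * a :=
        (mul_le_mul_of_nonneg_left c1 (by positivity)).trans
          (h.le.trans (mul_le_mul_of_nonneg_right v2 ha))
      refine le_of_mul_le_mul_left (this.trans' (le_of_eq ?_))
        (show 0 < Real.pi * (1 - k ^ 2) / k ^ 2 / 3 by positivity)
      field_simp
    · have : Real.pi * (1 - k ^ 2) * k / 3 * a
          ≤ Real.pi * 4 / 3 * (Real.pi * (1 - k ^ 2) / k ^ 2) :=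
        (mul_le_mul_of_nonneg_right v1 ha).trans
          (h.ge.trans (mul_le_mul_of_nonneg_left c2 (by positivity)))
      refine le_of_mul_le_mul_left (this.trans (le_of_eq ?_))
        (show 0 < Real.pi * (1 - k ^ 2) * k / 3 by positivity)
      field_simp
  have hev : ∀ᶠ k in 𝓝[<] (1 : ℝ), 0 < k ∧ k < 1 := by
    filter_upwards [Ioo_mem_nhdsLT (show (0 : ℝ) < 1 by norm_num)] with k hk using hk
  apply le_antisymm
  · have ht : Tendsto (fun k : ℝ => 4 * Real.pi / k ^ 3) (𝓝[<] 1) (𝓝 (4 * Real.pi / 1 ^ 3)) :=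
      ((continuousAt_const.div (continuousAt_id.pow 3) (by norm_num)).tendsto).mono_left
        nhdsWithin_le_nhds
    rw [one_pow, div_one] at ht
    exact ge_of_tendsto ht (hev.mono fun k hk => (key k hk.1 hk.2).2)
  · have ht : Tendsto (fun k : ℝ => 4 * Real.pi * k ^ 2) (𝓝[<] 1) (𝓝 (4 * Real.pi * 1 ^ 2)) :=
      ((continuousAt_const.mul (continuousAt_id.pow 2)).tendsto).mono_left
        nhdsWithin_le_nhds
    rw [one_pow, mul_one] at ht
    exact le_of_tendsto ht (hev.mono fun k hk => (key k hk.1 hk.2).1)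

/-! ### Area of lunes -/

/-- The rotation of angle `-t` around the polar axis. -/
noncomputable def polarRotation (t : ℝ) : E3 →ₗᵢ[ℝ] E3 where
  toFun ξ := !₂[Real.cos t * ξ 0 + Real.sin t * ξ 1, -Real.sin t * ξ 0 + Real.cos t * ξ 1, ξ 2]
  map_add' x y := by
    ext i
    fin_cases i <;> simp <;> ring
  map_smul' c x := by
    ext i
    fin_cases i <;> simp <;> ring
  norm_map' x := by
    rw [← sq_eq_sq₀ (norm_nonneg _) (norm_nonneg _), norm_sq_eq, norm_sq_eq]
    simp only [LinearMap.coe_mk, AddHom.coe_mk, Matrix.cons_val]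
    linear_combination (x 0 ^ 2 + x 1 ^ 2) * Real.cos_sq_add_sin_sq t

theorem hausdorff_preimage_polarRotation (t : ℝ) (s : Set E3) :
    μHE[2] (polarRotation t ⁻¹' s) = μHE[2] s :=
  hausdorff_preimage ((polarRotation t).toLinearIsometryEquiv rfl) s

theorem cos_nonneg_inter_Ioo {κ : ℝ} (h0 : 0 ≤ κ) (h1 : κ < Real.pi) :
    {t | 0 ≤ Real.cos t ∧ 0 ≤ Real.cos (t + κ)} ∩ Set.Ioo (-Real.pi) Real.pi
      = Set.Icc (-(Real.pi / 2)) (Real.pi / 2 - κ) ∩ Set.Ioo (-Real.pi) Real.pi := by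
  ext t
  simp only [Set.mem_inter_iff, Set.mem_ofPred_eq, Set.mem_Icc, Set.mem_Ioo]
  refine and_congr_left fun ⟨h2, h3⟩ => ⟨fun ⟨h4, h5⟩ => ?_, fun ⟨h4, h5⟩ => ?_⟩
  · have h6 : -(Real.pi / 2) ≤ t := by
      by_contra! h
      have := Real.cos_neg_of_pi_div_two_lt_of_lt (x := -t) (by linarith) (by linarith)
      rw [Real.cos_neg] at this
      linarith
    have h7 : t ≤ Real.pi / 2 := by
      by_contra! h
      have := Real.cos_neg_of_pi_div_two_lt_of_lt h (by linarith)
      linarith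
    refine ⟨h6, ?_⟩
    by_contra! h
    have := Real.cos_neg_of_pi_div_two_lt_of_lt (x := t + κ) (by linarith) (by linarith)
    linarith
  · exact ⟨Real.cos_nonneg_of_neg_pi_div_two_le_of_le h4 (by linarith),
      Real.cos_nonneg_of_neg_pi_div_two_le_of_le (by linarith) (by linarith)⟩

/-- Over a full period the phase `τ` is irrelevant; at `τ = 0` the set is an interval of length `π -
κ`. -/
theorem volume_cos_nonneg {κ : ℝ} (h0 : 0 ≤ κ) (h1 : κ < Real.pi) (τ : ℝ) :
    volume ({t | 0 ≤ Real.cos (t - τ) ∧ 0 ≤ Real.cos (t - τ + κ)} ∩ Set.Ioc (-Real.pi) Real.pi)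
      = ENNReal.ofReal (Real.pi - κ) := by
  have hpi := Real.pi_pos
  let P : Set ℝ := {t | 0 ≤ Real.cos t ∧ 0 ≤ Real.cos (t + κ)}
  have hP : MeasurableSet P := by
    have c1 : IsClosed {t : ℝ | 0 ≤ Real.cos t} := isClosed_le (by fun_prop) (by fun_prop)
    have c2 : IsClosed {t : ℝ | 0 ≤ Real.cos (t + κ)} := isClosed_le (by fun_prop) (by fun_prop)
    exact (c1.inter c2).measurableSet
  let g : ℝ → ℝ := P.indicator 1
  have hg : Function.Periodic g (2 * Real.pi) := by
    intro t
    have : t + 2 * Real.pi ∈ P ↔ t ∈ P := by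
      simp only [P, Set.mem_ofPred_eq]
      rw [Real.cos_add_two_pi, add_right_comm, Real.cos_add_two_pi]
    simp only [g, Set.indicator_apply, this, Pi.one_apply]
  have e1 : ∀ s : ℝ, (volume ((fun t => t - s) ⁻¹' P ∩ Set.Ioc (-Real.pi) Real.pi)).toReal
      = ∫ t in (-Real.pi)..Real.pi, g (t - s) := by
    intro s
    have hQ : MeasurableSet ((fun t => t - s) ⁻¹' P) := hP.preimage (by fun_prop)
    rw [intervalIntegral.integral_of_le (by linarith), ← Measure.restrict_apply hQ,
      ← measureReal_def, ← integral_indicator_one hQ]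
    rfl
  have e2 : ∫ t in (-Real.pi)..Real.pi, g (t - τ) = ∫ t in (-Real.pi)..Real.pi, g (t - 0) := by
    rw [intervalIntegral.integral_comp_sub_right, intervalIntegral.integral_comp_sub_right]
    have := hg.intervalIntegral_add_eq (-Real.pi - τ) (-Real.pi - 0)
    convert this using 2 <;> ring
  have e3 : volume ((fun t => t - 0) ⁻¹' P ∩ Set.Ioc (-Real.pi) Real.pi)
      = ENNReal.ofReal (Real.pi - κ) := by
    simp only [sub_zero, Set.preimage_id']
    rw [← measure_congr ((ae_eq_refl P).inter Ioo_ae_eq_Ioc), cos_nonneg_inter_Ioo h0 h1]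
    have hsub : Set.Icc (-(Real.pi / 2)) (Real.pi / 2 - κ) ⊆ Set.Ioo (-Real.pi) Real.pi :=
      fun t ht => ⟨by linarith [ht.1], by linarith [ht.2]⟩
    rw [Set.inter_eq_left.2 hsub, Real.volume_Icc]
    congr 1
    ring
  have hfin : volume ((fun t => t - τ) ⁻¹' P ∩ Set.Ioc (-Real.pi) Real.pi) ≠ ⊤ :=
    ((measure_mono Set.inter_subset_right).trans_lt (by simp [Real.volume_Ioc])).ne
  have := e1 τ
  rw [e2, ← e1, e3, ENNReal.toReal_ofReal (by linarith)] at this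
  rw [← this, ENNReal.ofReal_toReal hfin]
  rfl

theorem exists_polar {x y : ℝ} (h : x ≠ 0) :
    ∃ ρ τ : ℝ, 0 < ρ ∧ x = ρ * Real.cos τ ∧ y = ρ * Real.sin τ := by
  refine ⟨‖(⟨x, y⟩ : ℂ)‖, Complex.arg ⟨x, y⟩, ?_, ?_, ?_⟩
  · exact norm_pos_iff.2 fun h0 => h (congrArg Complex.re h0)
  · exact (Complex.norm_mul_cos_arg ⟨x, y⟩).symm
  · exact (Complex.norm_mul_sin_arg ⟨x, y⟩).symm

/-- Double counting of the pairs `(t, ξ)` with `ξ` in the lune rotated by `t`. For fixed `t` the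
area does not depend on `t`; for almost every `ξ` the admissible `t` have measure `π - κ`. Hence
`2π` times the area is `(π - κ) * 4π`. -/
theorem hausdorff_standard_lune {κ : ℝ} (h0 : 0 ≤ κ) (h1 : κ < Real.pi) :
    (μHE[2] : Measure E3).real
      {ξ | ‖ξ‖ = 1 ∧ 0 ≤ ξ 0 ∧ 0 ≤ Real.cos κ * ξ 0 + Real.sin κ * ξ 1} = 2 * (Real.pi - κ) := by
  have hpi := Real.pi_pos
  set L : Set E3 := {ξ | ‖ξ‖ = 1 ∧ 0 ≤ ξ 0 ∧ 0 ≤ Real.cos κ * ξ 0 + Real.sin κ * ξ 1}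
  let ν : Measure E3 := μHE[2].restrict (Metric.sphere 0 1)
  let lam : Measure ℝ := volume.restrict (Set.Ioc (-Real.pi) Real.pi)
  have : IsFiniteMeasure ν := ⟨by simpa [ν] using hausdorff_sphere_lt_top⟩
  let Q : Set (ℝ × E3) := {q | 0 ≤ Real.cos q.1 * q.2 0 + Real.sin q.1 * q.2 1 ∧
    0 ≤ Real.cos (q.1 + κ) * q.2 0 + Real.sin (q.1 + κ) * q.2 1}
  have hQ : MeasurableSet Q := by
    have c1 : IsClosed {q : ℝ × E3 | 0 ≤ Real.cos q.1 * q.2 0 + Real.sin q.1 * q.2 1} :=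
      isClosed_le (by fun_prop) (by fun_prop)
    have c2 : IsClosed {q : ℝ × E3 |
        0 ≤ Real.cos (q.1 + κ) * q.2 0 + Real.sin (q.1 + κ) * q.2 1} :=
      isClosed_le (by fun_prop) (by fun_prop)
    exact (c1.inter c2).measurableSet
  have i1 := Measure.prod_apply (μ := lam) (ν := ν) hQ
  have i2 := Measure.prod_apply_symm (μ := lam) (ν := ν) hQ
  have e1 : ∀ t, ν (Prod.mk t ⁻¹' Q) = μHE[2] L := by
    intro t
    rw [← hausdorff_preimage_polarRotation t L, Measure.restrict_apply (hQ.preimage (by fun_prop))]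
    congr 1
    ext ξ
    have h2 : Real.cos κ * (Real.cos t * ξ 0 + Real.sin t * ξ 1)
        + Real.sin κ * (-Real.sin t * ξ 0 + Real.cos t * ξ 1)
        = Real.cos (t + κ) * ξ 0 + Real.sin (t + κ) * ξ 1 := by
      rw [Real.cos_add, Real.sin_add]
      ring
    simp only [Q, L, Set.mem_inter_iff, Set.mem_preimage, Set.mem_ofPred_eq,
      mem_sphere_zero_iff_norm, LinearIsometry.norm_map]
    rw [← h2, and_comm]
    rfl
  have e2 : ∀ᵐ ξ ∂ν, lam ((fun t => (t, ξ)) ⁻¹' Q) = ENNReal.ofReal (Real.pi - κ) := by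
    -- Outside this null circle the horizontal part of `ξ` is nonzero and has polar coordinates.
    have hne : ∀ᵐ ξ ∂ν, ξ 0 ≠ 0 := by
      have hw : (EuclideanSpace.single 0 1 : E3) ≠ 0 := by
        intro h
        simpa using congrArg (fun v : E3 => v 0) h
      have hc : MeasurableSet {ξ : E3 | ξ 0 = 0} := by
        have : IsClosed {ξ : E3 | ξ 0 = 0} := isClosed_eq (by fun_prop) (by fun_prop)
        exact this.measurableSet
      rw [ae_iff]
      simp only [not_not]
      rw [Measure.restrict_apply hc]
      convert hausdorff_great_circle hw using 2
      ext ξ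
      simp [inner_eq, and_comm]
    filter_upwards [hne] with ξ hξ
    obtain ⟨ρ, τ, hρ, hx, hy⟩ := exists_polar (y := ξ 1) hξ
    rw [← volume_cos_nonneg h0 h1 τ, Measure.restrict_apply (hQ.preimage (by fun_prop))]
    congr 2
    ext t
    simp only [Q, Set.mem_preimage, Set.mem_ofPred_eq]
    have a1 : Real.cos t * ξ 0 + Real.sin t * ξ 1 = ρ * Real.cos (t - τ) := by
      rw [hx, hy, Real.cos_sub]; ring
    have a2 : Real.cos (t + κ) * ξ 0 + Real.sin (t + κ) * ξ 1 = ρ * Real.cos (t - τ + κ) := by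
      rw [hx, hy, sub_add_eq_add_sub, Real.cos_sub]; ring
    rw [a1, a2, mul_nonneg_iff_of_pos_left hρ, mul_nonneg_iff_of_pos_left hρ]
  rw [i1, lintegral_congr e1, lintegral_congr_ae e2, lintegral_const, lintegral_const] at i2
  simp only [ν, lam, Measure.restrict_apply_univ] at i2
  have i3 := congrArg ENNReal.toReal i2
  rw [ENNReal.toReal_mul, ENNReal.toReal_mul, Real.volume_Ioc,
    ENNReal.toReal_ofReal (by linarith), ENNReal.toReal_ofReal (by linarith),
    ← measureReal_def, ← measureReal_def, hausdorff_sphere] at i3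
  have : (2 * Real.pi) * (μHE[2] : Measure E3).real L
      = (2 * Real.pi) * (2 * (Real.pi - κ)) := by linarith
  exact mul_left_cancel₀ (by positivity) this

/-- Two reflections bring the lune to standard position: the first sends `m` to the first axis, the
second sends `n` into the equatorial plane. The second fixes the axis because `Φ n` and its target
`w` have equal inner products with it. -/
theorem hausdorff_lune {m n : E3} (hm : m ≠ 0) (hn : n ≠ 0)
    (h : InnerProductGeometry.angle m n ≠ Real.pi) :
    (μHE[2] : Measure E3).real {ξ | ‖ξ‖ = 1 ∧ 0 ≤ ⟪m, ξ⟫ ∧ 0 ≤ ⟪n, ξ⟫}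
      = 2 * (Real.pi - InnerProductGeometry.angle m n) := by
  set κ := InnerProductGeometry.angle m n with hκ
  rw [← hausdorff_standard_lune (InnerProductGeometry.angle_nonneg m n)
    (lt_of_le_of_ne (InnerProductGeometry.angle_le_pi m n) h), ← hκ]
  let e : E3 := EuclideanSpace.single 0 1
  let w : E3 := ‖n‖ • !₂[Real.cos κ, Real.sin κ, 0]
  have he : ‖e‖ = 1 := by simp [e]
  obtain ⟨Φ, hΦ⟩ := exists_linearIsometryEquiv_apply_eq (x := m) (y := ‖m‖ • e)
    (by simp [norm_smul, he])
  have hw : ‖Φ n‖ = ‖w‖ := by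
    rw [Φ.norm_map, ← sq_eq_sq₀ (norm_nonneg _) (norm_nonneg _), norm_sq_eq w]
    simp only [w, PiLp.smul_apply, smul_eq_mul, Matrix.cons_val]
    linear_combination (-‖n‖ ^ 2) * Real.cos_sq_add_sin_sq κ
  have hew : ⟪e, w⟫ = ‖n‖ * Real.cos κ := by simp [inner_eq, e, w]
  have hen : ⟪e, Φ n⟫ = ‖n‖ * Real.cos κ := by
    have : ⟪Φ m, Φ n⟫ = ‖m‖ * ⟪e, Φ n⟫ := by rw [hΦ, real_inner_smul_left]
    rw [Φ.inner_map_map, ← InnerProductGeometry.cos_angle_mul_norm_mul_norm] at this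
    have hm0 := norm_ne_zero_iff.2 hm
    apply mul_left_cancel₀ hm0
    rw [← this]
    ring
  let Ψ : E3 ≃ₗᵢ[ℝ] E3 := (ℝ ∙ (Φ n - w))ᗮ.reflection
  have hΨn : Ψ (Φ n) = w := Submodule.reflection_sub hw
  have hΨe : Ψ e = e := by
    refine Submodule.reflection_mem_subspace_eq_self
      (Submodule.mem_orthogonal_singleton_iff_inner_left.2 ?_)
    rw [inner_sub_right, hew, hen, sub_self]
  let Θ := Φ.trans Ψ
  have hΘm : Θ m = ‖m‖ • e := by simp [Θ, hΦ, hΨe]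
  have hΘn : Θ n = w := by simp [Θ, hΨn]
  rw [measureReal_def, measureReal_def]
  conv_rhs => rw [← hausdorff_preimage Θ]
  congr 2
  ext ξ
  simp only [Set.mem_preimage, Set.mem_ofPred_eq, Θ.norm_map]
  rw [← Θ.inner_map_map m ξ, ← Θ.inner_map_map n ξ, hΘm, hΘn]
  have a1 : ⟪‖m‖ • e, Θ ξ⟫ = ‖m‖ * (Θ ξ) 0 := by simp [inner_eq, e]
  have a2 : ⟪w, Θ ξ⟫ = ‖n‖ * (Real.cos κ * (Θ ξ) 0 + Real.sin κ * (Θ ξ) 1) := by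
    simp [inner_eq, w]; ring
  rw [a1, a2, mul_nonneg_iff_of_pos_left (norm_pos_iff.2 hm),
    mul_nonneg_iff_of_pos_left (norm_pos_iff.2 hn)]

/-! ### L'Huilier's formula -/

theorem two_mul_sin_mul_sin_of_half_sum (x y z : ℝ) :
    2 * (Real.sin (x + y + z) * Real.sin (y + z - x))
      = Real.cos (2 * x) - Real.cos (2 * y) * Real.cos (2 * z)
        + Real.sin (2 * y) * Real.sin (2 * z) := by
  simp only [Real.cos_two_mul, Real.sin_two_mul, Real.sin_add, Real.cos_add, Real.sin_sub]
  have hx := Real.sin_sq_add_cos_sq x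
  have hy := Real.sin_sq_add_cos_sq y
  have hz := Real.sin_sq_add_cos_sq z
  grind

theorem two_mul_sin_mul_sin_of_half_diff (x y z : ℝ) :
    2 * (Real.sin (z + x - y) * Real.sin (x + y - z))
      = Real.cos (2 * y) * Real.cos (2 * z) + Real.sin (2 * y) * Real.sin (2 * z)
        - Real.cos (2 * x) := by
  simp only [Real.cos_two_mul, Real.sin_two_mul, Real.sin_add, Real.cos_add, Real.sin_sub]
  have hx := Real.sin_sq_add_cos_sq x
  have hy := Real.sin_sq_add_cos_sq y
  have hz := Real.sin_sq_add_cos_sq z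
  grind

/-- The left side is what the expansion of `sin (p + q + r)` becomes once the half-angle formulas
are substituted. -/
theorem sin_half_perimeter_identity (x y z : ℝ) :
    Real.sin (x + y + z) * (Real.sin (z + x - y) * Real.sin (x + y - z)
        + Real.sin (y + z - x) * Real.sin (x + y - z) + Real.sin (y + z - x) * Real.sin (z + x - y))
      - Real.sin (y + z - x) * Real.sin (z + x - y) * Real.sin (x + y - z)
    = 2 * (1 + Real.cos (2 * x) + Real.cos (2 * y) + Real.cos (2 * z))
        * (Real.sin x * Real.sin y * Real.sin z) := by
  simp only [Real.cos_two_mul, Real.sin_add, Real.cos_add, Real.sin_sub]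
  have hx := Real.sin_sq_add_cos_sq x
  have hy := Real.sin_sq_add_cos_sq y
  have hz := Real.sin_sq_add_cos_sq z
  generalize Real.sin x = a at *
  generalize Real.sin y = b at *
  generalize Real.sin z = c at *
  generalize Real.cos x = u at *
  generalize Real.cos y = v at *
  generalize Real.cos z = w at *
  grind

/-- When the bracket equals `4 cos x cos y cos z * cos (E / 2)`, this product and the next are
proportional to `1 + cos (E / 2)` and `1 - cos (E / 2)`; their quotient is `tan (E / 4) ^ 2`. -/
theorem prod_cos_half_perimeter (x y z : ℝ) :
    8 * (Real.cos ((x + y + z) / 2) * Real.cos ((y + z - x) / 2) * Real.cos ((z + x - y) / 2)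
        * Real.cos ((x + y - z) / 2))
      = 4 * Real.cos x * Real.cos y * Real.cos z
        + (1 + Real.cos (2 * x) + Real.cos (2 * y) + Real.cos (2 * z)) := by
  obtain ⟨x, rfl⟩ : ∃ t, x = 2 * t := ⟨x / 2, by ring⟩
  obtain ⟨y, rfl⟩ : ∃ t, y = 2 * t := ⟨y / 2, by ring⟩
  obtain ⟨z, rfl⟩ : ∃ t, z = 2 * t := ⟨z / 2, by ring⟩
  rw [show (2 * x + 2 * y + 2 * z) / 2 = x + y + z by ring,
    show (2 * y + 2 * z - 2 * x) / 2 = y + z - x by ring,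
    show (2 * z + 2 * x - 2 * y) / 2 = z + x - y by ring,
    show (2 * x + 2 * y - 2 * z) / 2 = x + y - z by ring]
  simp only [Real.cos_two_mul, Real.sin_add, Real.cos_add, Real.cos_sub]
  have hx := Real.sin_sq_add_cos_sq x
  have hy := Real.sin_sq_add_cos_sq y
  have hz := Real.sin_sq_add_cos_sq z
  generalize Real.sin x = a at *
  generalize Real.sin y = b at *
  generalize Real.sin z = c at *
  generalize Real.cos x = u at *
  generalize Real.cos y = v at *
  generalize Real.cos z = w at *
  grind

theorem prod_sin_half_perimeter (x y z : ℝ) :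
    8 * (Real.sin ((x + y + z) / 2) * Real.sin ((y + z - x) / 2) * Real.sin ((z + x - y) / 2)
        * Real.sin ((x + y - z) / 2))
      = 4 * Real.cos x * Real.cos y * Real.cos z
        - (1 + Real.cos (2 * x) + Real.cos (2 * y) + Real.cos (2 * z)) := by
  obtain ⟨x, rfl⟩ : ∃ t, x = 2 * t := ⟨x / 2, by ring⟩
  obtain ⟨y, rfl⟩ : ∃ t, y = 2 * t := ⟨y / 2, by ring⟩
  obtain ⟨z, rfl⟩ : ∃ t, z = 2 * t := ⟨z / 2, by ring⟩
  rw [show (2 * x + 2 * y + 2 * z) / 2 = x + y + z by ring,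
    show (2 * y + 2 * z - 2 * x) / 2 = y + z - x by ring,
    show (2 * z + 2 * x - 2 * y) / 2 = z + x - y by ring,
    show (2 * x + 2 * y - 2 * z) / 2 = x + y - z by ring]
  simp only [Real.cos_two_mul, Real.sin_add, Real.cos_add, Real.sin_sub]
  have hx := Real.sin_sq_add_cos_sq x
  have hy := Real.sin_sq_add_cos_sq y
  have hz := Real.sin_sq_add_cos_sq z
  generalize Real.sin x = a at *
  generalize Real.sin y = b at *
  generalize Real.sin z = c at *
  generalize Real.cos x = u at *
  generalize Real.cos y = v at *
  generalize Real.cos z = w at *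
  grind

/-- The half-angle formulas in a spherical triangle with sides `2 x`, `2 y`, `2 z` and angle `2 p`
opposite to the side `2 x`. -/
theorem half_angle_formulas {x y z p : ℝ}
    (h : Real.cos (2 * x) = Real.cos (2 * y) * Real.cos (2 * z)
      + Real.sin (2 * y) * Real.sin (2 * z) * Real.cos (2 * p)) :
    Real.sin (2 * y) * Real.sin (2 * z) * Real.cos p ^ 2
        = Real.sin (x + y + z) * Real.sin (y + z - x) ∧
      Real.sin (2 * y) * Real.sin (2 * z) * Real.sin p ^ 2
        = Real.sin (z + x - y) * Real.sin (x + y - z) := by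
  have h1 := two_mul_sin_mul_sin_of_half_sum x y z
  have h2 := two_mul_sin_mul_sin_of_half_diff x y z
  have h3 := Real.cos_sq p
  have h4 := Real.sin_sq_add_cos_sq p
  constructor
  · rw [h3]; linarith
  · rw [show Real.sin p ^ 2 = 1 / 2 - Real.cos (2 * p) / 2 by linarith]; linarith

theorem eq_of_sq_mul_eq {k s t : ℝ} (hk : 0 < k) (hs : 0 ≤ s) (ht : 0 ≤ t)
    (h : (k * s) ^ 2 = t ^ 2) : k * s = t :=
  (sq_eq_sq₀ (by positivity) ht).1 h

/-- Otherwise both `y + z - x` and `z + x - y` would be negative, while their sum is `2 z`. -/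
theorem sin_half_perimeter_pos {x y z : ℝ} (hx0 : 0 < x) (hx : x < Real.pi / 2) (hy0 : 0 < y)
    (hy : y < Real.pi / 2) (hz0 : 0 < z) (hz : z < Real.pi / 2)
    (h1 : 0 < Real.sin (x + y + z) * Real.sin (y + z - x))
    (h2 : 0 < Real.sin (x + y + z) * Real.sin (z + x - y)) : 0 < Real.sin (x + y + z) := by
  by_contra! h0
  have la : y + z - x < 0 := by
    by_contra! h
    have := Real.sin_nonneg_of_nonneg_of_le_pi h (by linarith)
    exact h1.not_ge (mul_nonpos_of_nonpos_of_nonneg h0 this)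
  have lb : z + x - y < 0 := by
    by_contra! h
    have := Real.sin_nonneg_of_nonneg_of_le_pi h (by linarith)
    exact h2.not_ge (mul_nonpos_of_nonpos_of_nonneg h0 this)
  linarith

/-- L'Huilier's formula for sides `2 x`, `2 y`, `2 z`, opposite angles `2 p`, `2 q`, `2 r` and
excess `E`. The half-angle formulas express `cos (E / 2) = sin (p + q + r)` through the sides, and
the half-perimeter products then give `tan (E / 4) ^ 2`. The bounds `0 ≤ E < 2π` select the square
root and the branch of the arctangent. -/
theorem eq_four_mul_arctan {x y z p q r E : ℝ}
    (hx0 : 0 < x) (hx : x < Real.pi / 2) (hy0 : 0 < y) (hy : y < Real.pi / 2)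
    (hz0 : 0 < z) (hz : z < Real.pi / 2)
    (hp0 : 0 < p) (hp : p < Real.pi / 2) (hq0 : 0 < q) (hq : q < Real.pi / 2)
    (hr0 : 0 < r) (hr : r < Real.pi / 2)
    (hxp : Real.cos (2 * x) = Real.cos (2 * y) * Real.cos (2 * z)
      + Real.sin (2 * y) * Real.sin (2 * z) * Real.cos (2 * p))
    (hyq : Real.cos (2 * y) = Real.cos (2 * z) * Real.cos (2 * x)
      + Real.sin (2 * z) * Real.sin (2 * x) * Real.cos (2 * q))
    (hzr : Real.cos (2 * z) = Real.cos (2 * x) * Real.cos (2 * y)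
      + Real.sin (2 * x) * Real.sin (2 * y) * Real.cos (2 * r))
    (hE : E = 2 * p + 2 * q + 2 * r - Real.pi) (hE0 : 0 ≤ E) :
    E = 4 * Real.arctan √(Real.tan ((x + y + z) / 2) * Real.tan ((y + z - x) / 2)
      * Real.tan ((z + x - y) / 2) * Real.tan ((x + y - z) / 2)) := by
  have hpi := Real.pi_pos
  obtain ⟨cp, sp⟩ := half_angle_formulas hxp
  obtain ⟨cq, sq⟩ := half_angle_formulas hyq
  obtain ⟨cr, sr⟩ := half_angle_formulas hzr
  rw [show y + z + x = x + y + z by ring] at cq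
  rw [show z + x + y = x + y + z by ring] at cr
  have pos : ∀ t, 0 < t → t < Real.pi / 2 →
      0 < Real.sin (2 * t) ∧ 0 < Real.sin t ∧ 0 < Real.cos t := fun t h0 h1 =>
    ⟨Real.sin_pos_of_pos_of_lt_pi (by linarith) (by linarith),
      Real.sin_pos_of_pos_of_lt_pi (by linarith) (by linarith),
      Real.cos_pos_of_mem_Ioo ⟨by linarith, h1⟩⟩
  obtain ⟨px, psx, pcx⟩ := pos x hx0 hx
  obtain ⟨py, psy, pcy⟩ := pos y hy0 hy
  obtain ⟨pz, psz, pcz⟩ := pos z hz0 hz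
  obtain ⟨-, psp, pcp⟩ := pos p hp0 hp
  obtain ⟨-, psq, pcq⟩ := pos q hq0 hq
  obtain ⟨-, psr, pcr⟩ := pos r hr0 hr
  have id1 := sin_half_perimeter_identity x y z
  have hs0 : 0 < Real.sin (x + y + z) :=
    sin_half_perimeter_pos hx0 hx hy0 hy hz0 hz (by rw [← cp]; positivity)
      (by rw [← cq]; positivity)
  have hsa : 0 < Real.sin (y + z - x) := by
    refine pos_of_mul_pos_right ?_ hs0.le
    rw [← cp]; positivity
  have hsb : 0 < Real.sin (z + x - y) := by
    refine pos_of_mul_pos_right ?_ hs0.le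
    rw [← cq]; positivity
  have hsc : 0 < Real.sin (x + y - z) := by
    refine pos_of_mul_pos_right ?_ hs0.le
    rw [← cr]; positivity
  have hcos : Real.cos (E / 2) * (4 * (Real.cos x * Real.cos y * Real.cos z))
      = 1 + Real.cos (2 * x) + Real.cos (2 * y) + Real.cos (2 * z) := by
    have e0 : Real.cos (E / 2) = Real.sin p * Real.cos q * Real.cos r
        + Real.cos p * Real.sin q * Real.cos r + Real.cos p * Real.cos q * Real.sin r
        - Real.sin p * Real.sin q * Real.sin r := by
      rw [hE, show (2 * p + 2 * q + 2 * r - Real.pi) / 2 = p + q + r - Real.pi / 2 by ring,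
        Real.cos_sub_pi_div_two]
      simp only [Real.sin_add, Real.cos_add]
      ring
    -- Multiplied by `k`, each product of three half-angle factors has as its square a product of
    -- three half-angle formulas; positivity permits taking roots.
    set k := Real.sin (2 * x) * Real.sin (2 * y) * Real.sin (2 * z) with hk
    have k0 : 0 < k := by positivity
    have t1 : k * (Real.sin p * Real.cos q * Real.cos r)
        = Real.sin (x + y + z) * (Real.sin (z + x - y) * Real.sin (x + y - z)) := by
      refine eq_of_sq_mul_eq k0 (by positivity) (by positivity) ?_
      calc _ = (Real.sin (2 * y) * Real.sin (2 * z) * Real.sin p ^ 2)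
            * (Real.sin (2 * z) * Real.sin (2 * x) * Real.cos q ^ 2)
            * (Real.sin (2 * x) * Real.sin (2 * y) * Real.cos r ^ 2) := by rw [hk]; ring
        _ = _ := by rw [sp, cq, cr]; ring
    have t2 : k * (Real.cos p * Real.sin q * Real.cos r)
        = Real.sin (x + y + z) * (Real.sin (y + z - x) * Real.sin (x + y - z)) := by
      refine eq_of_sq_mul_eq k0 (by positivity) (by positivity) ?_
      calc _ = (Real.sin (2 * y) * Real.sin (2 * z) * Real.cos p ^ 2)
            * (Real.sin (2 * z) * Real.sin (2 * x) * Real.sin q ^ 2)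
            * (Real.sin (2 * x) * Real.sin (2 * y) * Real.cos r ^ 2) := by rw [hk]; ring
        _ = _ := by rw [cp, sq, cr]; ring
    have t3 : k * (Real.cos p * Real.cos q * Real.sin r)
        = Real.sin (x + y + z) * (Real.sin (y + z - x) * Real.sin (z + x - y)) := by
      refine eq_of_sq_mul_eq k0 (by positivity) (by positivity) ?_
      calc _ = (Real.sin (2 * y) * Real.sin (2 * z) * Real.cos p ^ 2)
            * (Real.sin (2 * z) * Real.sin (2 * x) * Real.cos q ^ 2)
            * (Real.sin (2 * x) * Real.sin (2 * y) * Real.sin r ^ 2) := by rw [hk]; ring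
        _ = _ := by rw [cp, cq, sr]; ring
    have t4 : k * (Real.sin p * Real.sin q * Real.sin r)
        = Real.sin (y + z - x) * Real.sin (z + x - y) * Real.sin (x + y - z) := by
      refine eq_of_sq_mul_eq k0 (by positivity) (by positivity) ?_
      calc _ = (Real.sin (2 * y) * Real.sin (2 * z) * Real.sin p ^ 2)
            * (Real.sin (2 * z) * Real.sin (2 * x) * Real.sin q ^ 2)
            * (Real.sin (2 * x) * Real.sin (2 * y) * Real.sin r ^ 2) := by rw [hk]; ring
        _ = _ := by rw [sp, sq, sr]; ring
    have t5 : k * Real.cos (E / 2)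
        = 2 * (1 + Real.cos (2 * x) + Real.cos (2 * y) + Real.cos (2 * z))
          * (Real.sin x * Real.sin y * Real.sin z) := by
      rw [e0, ← id1]
      linear_combination t1 + t2 + t3 - t4
    have hk2 : k = 8 * (Real.sin x * Real.sin y * Real.sin z)
        * (Real.cos x * Real.cos y * Real.cos z) := by
      rw [hk, Real.sin_two_mul, Real.sin_two_mul, Real.sin_two_mul]
      ring
    have h3 : 0 < Real.sin x * Real.sin y * Real.sin z := by positivity
    apply mul_left_cancel₀ h3.ne'
    rw [hk2] at t5
    linear_combination t5 / 2
  have c0 : 0 < Real.cos x * Real.cos y * Real.cos z := by positivity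
  have pc := prod_cos_half_perimeter x y z
  have ps := prod_sin_half_perimeter x y z
  rw [← hcos] at pc ps
  have hE4 : E / 4 < Real.pi / 2 := by linarith
  have hc4 : 0 < Real.cos (E / 4) := Real.cos_pos_of_mem_Ioo ⟨by linarith, hE4⟩
  have hd1 := Real.cos_sq (E / 4)
  have hd2 := Real.sin_sq_add_cos_sq (E / 4)
  rw [show 2 * (E / 4) = E / 2 by ring] at hd1
  have hprod : Real.tan ((x + y + z) / 2) * Real.tan ((y + z - x) / 2)
      * Real.tan ((z + x - y) / 2) * Real.tan ((x + y - z) / 2) = Real.tan (E / 4) ^ 2 := by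
    simp only [Real.tan_eq_sin_div_cos, div_mul_div_comm, div_pow]
    have hne : Real.cos ((x + y + z) / 2) * Real.cos ((y + z - x) / 2)
        * Real.cos ((z + x - y) / 2) * Real.cos ((x + y - z) / 2)
        = (Real.cos x * Real.cos y * Real.cos z) * Real.cos (E / 4) ^ 2 := by
      rw [hd1]; linear_combination pc / 8
    have hns : Real.sin ((x + y + z) / 2) * Real.sin ((y + z - x) / 2)
        * Real.sin ((z + x - y) / 2) * Real.sin ((x + y - z) / 2)
        = (Real.cos x * Real.cos y * Real.cos z) * Real.sin (E / 4) ^ 2 := by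
      rw [show Real.sin (E / 4) ^ 2 = 1 / 2 - Real.cos (E / 2) / 2 by linarith]
      linear_combination ps / 8
    rw [hne, hns, mul_div_mul_left _ _ c0.ne']
  rw [hprod, Real.sqrt_sq (Real.tan_nonneg_of_nonneg_of_le_pi_div_two (by linarith) hE4.le),
    Real.arctan_tan (by linarith) hE4]
  ring

/-! ### Girard's theorem -/

/-- The cross product of two vectors of Euclidean three-space. -/
noncomputable def cross (u v : E3) : E3 :=
  !₂[u 1 * v 2 - u 2 * v 1, u 2 * v 0 - u 0 * v 2, u 0 * v 1 - u 1 * v 0]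

theorem inner_cross (u v w : E3) : ⟪cross u v, w⟫ = det3 u v w := by
  simp only [inner_eq, det3_eq, cross, Matrix.cons_val]
  ring

theorem inner_cross_cross (u v w z : E3) :
    ⟪cross u v, cross w z⟫ = ⟪u, w⟫ * ⟪v, z⟫ - ⟪u, z⟫ * ⟪v, w⟫ := by
  simp only [inner_eq, cross, Matrix.cons_val]
  ring

theorem norm_cross (u v : E3) : ‖cross u v‖ = Real.sin (angle u v) * (‖u‖ * ‖v‖) := by
  rw [sin_angle_mul_norm_mul_norm, norm_eq_sqrt_real_inner, inner_cross_cross,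
    real_inner_comm u v]

/-- Normals of two adjacent faces have cross product along the common edge. For independent vectors
it is nonzero, so the angles of the triangle are strictly between `0` and `π`. -/
theorem cross_cross (u v w : E3) : cross (cross u v) (cross v w) = det3 u v w • v := by
  ext i
  fin_cases i <;> simp [cross, det3_eq] <;> ring

theorem angle_mem_Ioo_of_cross_ne_zero {u v : E3} (h : cross u v ≠ 0) :
    0 < angle u v ∧ angle u v < Real.pi := by
  have hs : Real.sin (angle u v) ≠ 0 := fun h0 => h <| by
    rw [← norm_eq_zero, norm_cross, h0, zero_mul]
  refine ⟨(angle_nonneg u v).lt_of_ne fun h0 => hs ?_,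
    (angle_le_pi u v).lt_of_ne fun h0 => hs ?_⟩
  · rw [← h0, Real.sin_zero]
  · rw [h0, Real.sin_pi]

theorem cross_zero_left (v : E3) : cross 0 v = 0 := by
  ext i
  fin_cases i <;> simp [cross]

theorem cross_zero_right (v : E3) : cross v 0 = 0 := by
  ext i
  fin_cases i <;> simp [cross]

/-- The spherical law of cosines. -/
theorem cos_angle_eq {u v w : E3} (hwu : cross w u ≠ 0) (huv : cross u v ≠ 0) :
    Real.cos (angle v w) = Real.cos (angle w u) * Real.cos (angle u v)
      + Real.sin (angle w u) * Real.sin (angle u v)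
        * Real.cos (Real.pi - angle (cross w u) (cross u v)) := by
  have hu : u ≠ 0 := by rintro rfl; exact hwu (cross_zero_right w)
  have hv : v ≠ 0 := by rintro rfl; exact huv (cross_zero_right u)
  have hw : w ≠ 0 := by rintro rfl; exact hwu (cross_zero_left u)
  -- Expanding `⟪w × u, u × v⟫` gives `⟪w, u⟫ * ⟪u, v⟫ - ‖u‖ ^ 2 * ⟪w, v⟫`; the orientation of the
  -- two normals is why the angle at `u` is the supplement of theirs.
  have h := cos_angle_mul_norm_mul_norm (cross w u) (cross u v)
  rw [norm_cross, norm_cross, inner_cross_cross, ← cos_angle_mul_norm_mul_norm w u,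
    ← cos_angle_mul_norm_mul_norm u v, ← cos_angle_mul_norm_mul_norm w v,
    real_inner_self_eq_norm_sq, angle_comm w v] at h
  have hu' := norm_pos_iff.2 hu
  have hv' := norm_pos_iff.2 hv
  have hw' := norm_pos_iff.2 hw
  have hk : 0 < ‖u‖ ^ 2 * ‖v‖ * ‖w‖ := by positivity
  rw [Real.cos_pi_sub]
  apply mul_left_cancel₀ hk.ne'
  linear_combination h

theorem measurableSet_half_space (m : E3) : MeasurableSet {ξ : E3 | 0 ≤ ⟪m, ξ⟫} := by
  have : IsClosed {ξ : E3 | 0 ≤ ⟪m, ξ⟫} := isClosed_le (by fun_prop) (by fun_prop)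
  exact this.measurableSet

/-- The antipodal map exchanges the signs, and strict and weak inequalities differ by great circles
only. -/
theorem hausdorff_triangle_neg {m : Fin 3 → E3} (hm : ∀ i, m i ≠ 0) :
    μHE[2] {ξ : E3 | ‖ξ‖ = 1 ∧ ∀ i, ⟪m i, ξ⟫ < 0}
      = μHE[2] {ξ : E3 | ‖ξ‖ = 1 ∧ ∀ i, 0 ≤ ⟪m i, ξ⟫} := by
  rw [← hausdorff_preimage (LinearIsometryEquiv.neg ℝ)]
  have e : (LinearIsometryEquiv.neg ℝ) ⁻¹' {ξ : E3 | ‖ξ‖ = 1 ∧ ∀ i, ⟪m i, ξ⟫ < 0}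
      = {ξ : E3 | ‖ξ‖ = 1 ∧ ∀ i, 0 < ⟪m i, ξ⟫} := by
    ext ξ
    simp
  rw [e]
  refine le_antisymm (measure_mono fun ξ h => ⟨h.1, fun i => (h.2 i).le⟩) ?_
  have hsub : {ξ : E3 | ‖ξ‖ = 1 ∧ ∀ i, 0 ≤ ⟪m i, ξ⟫}
      ⊆ {ξ : E3 | ‖ξ‖ = 1 ∧ ∀ i, 0 < ⟪m i, ξ⟫} ∪ ⋃ i, {ξ : E3 | ‖ξ‖ = 1 ∧ ⟪m i, ξ⟫ = 0} := by
    rintro ξ ⟨h1, h2⟩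
    by_cases h : ∀ i, 0 < ⟪m i, ξ⟫
    · exact Or.inl ⟨h1, h⟩
    · push Not at h
      obtain ⟨i, hi⟩ := h
      exact Or.inr (Set.mem_iUnion.2 ⟨i, h1, le_antisymm hi (h2 i)⟩)
  refine (measure_mono hsub).trans ((measure_union_le _ _).trans ?_)
  rw [measure_iUnion_null fun i => hausdorff_great_circle (hm i), add_zero]

/-- **Girard's theorem**, for the triangle cut out by three half-spaces. -/
theorem hausdorff_triangle {m : Fin 3 → E3} (hm : ∀ i, m i ≠ 0)
    (h01 : angle (m 0) (m 1) ≠ Real.pi) (h12 : angle (m 1) (m 2) ≠ Real.pi)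
    (h20 : angle (m 2) (m 0) ≠ Real.pi) :
    (μHE[2] : Measure E3).real {ξ | ‖ξ‖ = 1 ∧ ∀ i, 0 ≤ ⟪m i, ξ⟫}
      = (Real.pi - angle (m 0) (m 1)) + (Real.pi - angle (m 1) (m 2))
        + (Real.pi - angle (m 2) (m 0)) - Real.pi := by
  let ν : Measure E3 := μHE[2].restrict (Metric.sphere 0 1)
  have : IsFiniteMeasure ν := ⟨by simpa [ν] using hausdorff_sphere_lt_top⟩
  let P : Fin 3 → Set E3 := fun i => {ξ | 0 ≤ ⟪m i, ξ⟫}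
  have hP : ∀ i, MeasurableSet (P i) := fun i => measurableSet_half_space (m i)
  have hν : ∀ s, MeasurableSet s → ν.real s = (μHE[2] : Measure E3).real (s ∩ {ξ | ‖ξ‖ = 1}) := by
    intro s hs
    rw [measureReal_def, measureReal_def, Measure.restrict_apply hs]
    congr 3
    ext ξ
    exact mem_sphere_zero_iff_norm
  have lune : ∀ i j, angle (m i) (m j) ≠ Real.pi →
      ν.real (P i ∩ P j) = 2 * (Real.pi - angle (m i) (m j)) := by
    intro i j hij
    rw [← hausdorff_lune (hm i) (hm j) hij, hν _ ((hP i).inter (hP j))]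
    congr 1
    ext ξ
    simp only [P, Set.mem_inter_iff, Set.mem_ofPred_eq]
    tauto
  -- A hemisphere is the lune of a vector with itself.
  have half : ∀ i, ν.real (P i) = 2 * Real.pi := by
    intro i
    have := lune i i (by rw [angle_self (hm i)]; exact Real.pi_pos.ne)
    rwa [Set.inter_self, angle_self (hm i), sub_zero] at this
  have htri : ν.real (P 0 ∩ P 1 ∩ P 2)
      = (μHE[2] : Measure E3).real {ξ | ‖ξ‖ = 1 ∧ ∀ i, 0 ≤ ⟪m i, ξ⟫} := by
    rw [hν _ (((hP 0).inter (hP 1)).inter (hP 2))]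
    congr 1
    ext ξ
    simp only [P, Set.mem_inter_iff, Set.mem_ofPred_eq, Fin.forall_fin_succ,
      IsEmpty.forall_iff]
    tauto
  -- The complement of the three hemispheres is the open antipodal triangle, so inclusion–exclusion
  -- reads `4π - T = 3 * 2π - (sum of the lunes) + T`.
  have hcompl : ν.real (P 0 ∪ P 1 ∪ P 2)ᶜ
      = (μHE[2] : Measure E3).real {ξ | ‖ξ‖ = 1 ∧ ∀ i, 0 ≤ ⟪m i, ξ⟫} := by
    rw [hν _ (((hP 0).union (hP 1)).union (hP 2)).compl, measureReal_def, measureReal_def,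
      ← hausdorff_triangle_neg hm]
    congr 2
    ext ξ
    simp only [P, Set.mem_inter_iff, Set.mem_compl_iff, Set.mem_union, Set.mem_ofPred_eq,
      Fin.forall_fin_succ, IsEmpty.forall_iff, not_or, not_le]
    tauto
  have huniv : ν.real (P 0 ∪ P 1 ∪ P 2) + ν.real (P 0 ∪ P 1 ∪ P 2)ᶜ = 4 * Real.pi := by
    rw [measureReal_add_measureReal_compl (((hP 0).union (hP 1)).union (hP 2)),
      ← hausdorff_sphere, measureReal_def, measureReal_def, Measure.restrict_apply_univ]
  have i1 := measureReal_union_add_inter (μ := ν) (s := P 0 ∪ P 1) (hP 2)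
  have i2 := measureReal_union_add_inter (μ := ν) (s := P 0) (hP 1)
  have i3 := measureReal_union_add_inter (μ := ν) (s := P 0 ∩ P 2) ((hP 1).inter (hP 2))
  rw [Set.union_inter_distrib_right] at i1
  rw [show P 0 ∩ P 2 ∩ (P 1 ∩ P 2) = P 0 ∩ P 1 ∩ P 2 by ext; simp; tauto] at i3
  rw [Set.inter_comm (P 0) (P 2), lune 2 0 h20, lune 1 2 h12] at i3
  rw [lune 0 1 h01, half, half] at i2
  rw [Set.inter_comm (P 0) (P 2), half] at i1
  linarith

/-- Cramer's rule with the denominator cleared. -/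
theorem eq_sum_inner_cross_smul (u : Fin 3 → E3) (ξ : E3) :
    det3 (u 0) (u 1) (u 2) • ξ = ⟪cross (u 1) (u 2), ξ⟫ • u 0 + ⟪cross (u 2) (u 0), ξ⟫ • u 1
      + ⟪cross (u 0) (u 1), ξ⟫ • u 2 := by
  simp only [inner_cross]
  ext i
  fin_cases i <;> simp [det3_eq] <;> ring

theorem inner_cross_sum (u : Fin 3 → E3) (c : Fin 3 → ℝ) :
    ⟪cross (u 1) (u 2), ∑ i, c i • u i⟫ = c 0 * det3 (u 0) (u 1) (u 2) ∧
    ⟪cross (u 2) (u 0), ∑ i, c i • u i⟫ = c 1 * det3 (u 0) (u 1) (u 2) ∧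
    ⟪cross (u 0) (u 1), ∑ i, c i • u i⟫ = c 2 * det3 (u 0) (u 1) (u 2) := by
  simp only [Fin.sum_univ_three, inner_add_right, real_inner_smul_right, inner_cross, det3_eq]
  refine ⟨?_, ?_, ?_⟩ <;> ring

/-- The basis dual to a basis `u` of Euclidean three-space. -/
noncomputable def dualBasis (u : Fin 3 → E3) : Fin 3 → E3 :=
  (det3 (u 0) (u 1) (u 2))⁻¹ • ![cross (u 1) (u 2), cross (u 2) (u 0), cross (u 0) (u 1)]

theorem inner_dualBasis_sum {u : Fin 3 → E3} (hu : det3 (u 0) (u 1) (u 2) ≠ 0) (c : Fin 3 → ℝ)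
    (i : Fin 3) : ⟪dualBasis u i, ∑ i, c i • u i⟫ = c i := by
  obtain ⟨h0, h1, h2⟩ := inner_cross_sum u c
  fin_cases i <;>
    simp only [dualBasis, Pi.smul_apply, real_inner_smul_left, Fin.mk_zero, Fin.mk_one,
      Fin.reduceFinMk, Matrix.cons_val, h0, h1, h2] <;> field_simp

theorem sum_inner_dualBasis {u : Fin 3 → E3} (hu : det3 (u 0) (u 1) (u 2) ≠ 0) (ξ : E3) :
    ξ = ∑ i, ⟪dualBasis u i, ξ⟫ • u i := by
  calc ξ = (det3 (u 0) (u 1) (u 2))⁻¹ • det3 (u 0) (u 1) (u 2) • ξ := (inv_smul_smul₀ hu ξ).symm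
    _ = _ := by
      rw [eq_sum_inner_cross_smul u ξ, smul_add, smul_add]
      simp only [smul_smul, Fin.sum_univ_three, dualBasis, Pi.smul_apply, real_inner_smul_left,
        Matrix.cons_val]

/-- The coefficients of `ξ` in the basis `u` are its inner products with the dual basis. This is the
half-space form needed for Girard's theorem. -/
theorem sphericalTriangle_eq {u : Fin 3 → E3} (hu : det3 (u 0) (u 1) (u 2) ≠ 0) :
    sphericalTriangle u = {ξ | ‖ξ‖ = 1 ∧ ∀ i, 0 ≤ ⟪dualBasis u i, ξ⟫} := by
  ext ξ
  refine and_congr_right fun _ => ⟨?_, fun h => ⟨_, h, sum_inner_dualBasis hu ξ⟩⟩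
  rintro ⟨c, hc, rfl⟩ i
  rw [inner_dualBasis_sum hu]
  exact hc i

/-- The angles of the triangle are the supplements of the angles between dual vectors. Girard's
theorem gives the area as their excess, and the law of cosines at each vertex supplies the
hypotheses of L'Huilier's formula. -/
theorem hausdorff_sphericalTriangle {u : Fin 3 → E3} (hu : det3 (u 0) (u 1) (u 2) ≠ 0)
    {a b c σ : ℝ} (ha : a = angle (u 1) (u 2)) (hb : b = angle (u 2) (u 0))
    (hc : c = angle (u 0) (u 1)) (hσ : σ = (a + b + c) / 2) :
    (μHE[2] : Measure E3).real (sphericalTriangle u)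
      = 4 * Real.arctan √(Real.tan (σ / 2) * Real.tan ((σ - a) / 2) * Real.tan ((σ - b) / 2)
        * Real.tan ((σ - c) / 2)) := by
  have hpi := Real.pi_pos
  have d1 : det3 (u 1) (u 2) (u 0) = det3 (u 0) (u 1) (u 2) := by simp only [det3_eq]; ring
  have d2 : det3 (u 2) (u 0) (u 1) = det3 (u 0) (u 1) (u 2) := by simp only [det3_eq]; ring
  have n0 : cross (u 1) (u 2) ≠ 0 := fun h => hu <| by rw [← d1, ← inner_cross, h, inner_zero_left]
  have n1 : cross (u 2) (u 0) ≠ 0 := fun h => hu <| by rw [← d2, ← inner_cross, h, inner_zero_left]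
  have n2 : cross (u 0) (u 1) ≠ 0 := fun h => hu <| by rw [← inner_cross, h, inner_zero_left]
  have hne : ∀ {v w : E3}, cross v w ≠ 0 → w ≠ 0 := by
    rintro v w h rfl
    exact h (cross_zero_right v)
  have hD := inv_ne_zero hu
  have m0 : cross (cross (u 1) (u 2)) (cross (u 2) (u 0)) ≠ 0 := by
    rw [cross_cross, d1]; exact smul_ne_zero hu (hne n0)
  have m1 : cross (cross (u 2) (u 0)) (cross (u 0) (u 1)) ≠ 0 := by
    rw [cross_cross, d2]; exact smul_ne_zero hu (hne n1)
  have m2 : cross (cross (u 0) (u 1)) (cross (u 1) (u 2)) ≠ 0 := by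
    rw [cross_cross]; exact smul_ne_zero hu (hne n2)
  have b0 := angle_mem_Ioo_of_cross_ne_zero m0
  have b1 := angle_mem_Ioo_of_cross_ne_zero m1
  have b2 := angle_mem_Ioo_of_cross_ne_zero m2
  obtain ⟨a0, a1⟩ := angle_mem_Ioo_of_cross_ne_zero n0
  obtain ⟨a2, a3⟩ := angle_mem_Ioo_of_cross_ne_zero n1
  obtain ⟨a4, a5⟩ := angle_mem_Ioo_of_cross_ne_zero n2
  have e0 : dualBasis u 0 = (det3 (u 0) (u 1) (u 2))⁻¹ • cross (u 1) (u 2) := rfl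
  have e1 : dualBasis u 1 = (det3 (u 0) (u 1) (u 2))⁻¹ • cross (u 2) (u 0) := rfl
  have e2 : dualBasis u 2 = (det3 (u 0) (u 1) (u 2))⁻¹ • cross (u 0) (u 1) := rfl
  -- The scalar may be negative, but it multiplies both vectors and so preserves the angle.
  have t0 : angle (dualBasis u 0) (dualBasis u 1)
      = angle (cross (u 1) (u 2)) (cross (u 2) (u 0)) := by rw [e0, e1, angle_smul_smul hD]
  have t1 : angle (dualBasis u 1) (dualBasis u 2)
      = angle (cross (u 2) (u 0)) (cross (u 0) (u 1)) := by rw [e1, e2, angle_smul_smul hD]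
  have t2 : angle (dualBasis u 2) (dualBasis u 0)
      = angle (cross (u 0) (u 1)) (cross (u 1) (u 2)) := by rw [e2, e0, angle_smul_smul hD]
  have hm : ∀ i, dualBasis u i ≠ 0 := by
    intro i
    fin_cases i
    · exact smul_ne_zero hD n0
    · exact smul_ne_zero hD n1
    · exact smul_ne_zero hD n2
  have hg := hausdorff_triangle hm (by rw [t0]; exact b0.2.ne) (by rw [t1]; exact b1.2.ne)
    (by rw [t2]; exact b2.2.ne)
  rw [← sphericalTriangle_eq hu, t0, t1, t2] at hg
  have l0 := cos_angle_eq n1 n2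
  have l1 := cos_angle_eq n2 n0
  have l2 := cos_angle_eq n0 n1
  rw [← ha, ← hb, ← hc] at l0 l1 l2
  rw [← ha] at a0 a1
  rw [← hb] at a2 a3
  rw [← hc] at a4 a5
  have half : ∀ t : ℝ, 2 * (t / 2) = t := fun t => by ring
  have := eq_four_mul_arctan (x := a / 2) (y := b / 2) (z := c / 2)
    (p := (Real.pi - angle (cross (u 2) (u 0)) (cross (u 0) (u 1))) / 2)
    (q := (Real.pi - angle (cross (u 0) (u 1)) (cross (u 1) (u 2))) / 2)
    (r := (Real.pi - angle (cross (u 1) (u 2)) (cross (u 2) (u 0))) / 2)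
    (E := (μHE[2] : Measure E3).real (sphericalTriangle u))
    (by linarith) (by linarith) (by linarith) (by linarith) (by linarith) (by linarith)
    (by linarith [b1.2]) (by linarith [b1.1]) (by linarith [b2.2]) (by linarith [b2.1])
    (by linarith [b0.2]) (by linarith [b0.1])
    (by simpa only [half] using l0) (by simpa only [half] using l1)
    (by simpa only [half] using l2) (by linarith) measureReal_nonneg
  rw [this, hσ]
  congr 3
  ring_nf

/-! ### Normal cones of intersections of balls -/

section Balls

variable {ι : Type*} {A : ι → E3} {p : E3} {r : ℝ}

theorem mem_closedBall_iff_inner {a x : E3} (hr : 0 < r) (hp : p ∈ Metric.sphere a r) :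
    x ∈ Metric.closedBall a r ↔ 2 * ⟪p - a, x - p⟫ + ‖x - p‖ ^ 2 ≤ 0 := by
  rw [mem_sphere_iff_norm] at hp
  rw [mem_closedBall_iff_norm, show x - a = (p - a) + (x - p) by abel,
    ← sq_le_sq₀ (norm_nonneg _) hr.le, norm_add_sq_real, hp]
  constructor <;> intro h <;> linarith

theorem inner_nonpos_of_mem_closedBall {a x : E3} (hr : 0 < r) (hp : p ∈ Metric.sphere a r)
    (hx : x ∈ Metric.closedBall a r) : ⟪p - a, x - p⟫ ≤ 0 := by
  have := (mem_closedBall_iff_inner hr hp).1 hx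
  nlinarith [sq_nonneg ‖x - p‖]

/-- At `p + t • v` the ball inequality is `t * (2 * ⟪p - a, v⟫ + t * ‖v‖ ^ 2) ≤ 0`, and the bracket
is negative for small `t`. -/
theorem eventually_mem_closedBall {a v : E3} (hr : 0 < r) (hp : p ∈ Metric.sphere a r)
    (hv : ⟪p - a, v⟫ < 0) : ∀ᶠ t : ℝ in 𝓝[>] 0, p + t • v ∈ Metric.closedBall a r := by
  have hc : Tendsto (fun t : ℝ => 2 * ⟪p - a, v⟫ + t * ‖v‖ ^ 2) (𝓝[>] 0)
      (𝓝 (2 * ⟪p - a, v⟫ + 0 * ‖v‖ ^ 2)) :=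
    (Continuous.tendsto (by fun_prop) 0).mono_left nhdsWithin_le_nhds
  filter_upwards [hc.eventually_lt_const (u := 0) (by linarith), self_mem_nhdsWithin] with t h1 h2
  have h2 : 0 < t := h2
  rw [mem_closedBall_iff_inner hr hp, add_sub_cancel_left, real_inner_smul_right, norm_smul,
    mul_pow, Real.norm_eq_abs, sq_abs]
  nlinarith

/-- Strictly inward directions stay in the intersection for small times, so a normal is nonpositive
on them. The common strictly inward `v₀` lets a weakly inward `v` be approximated by `v + ε • v₀`.
-/
theorem inner_nonpos_of_mem_unitNormalCone (hr : 0 < r) (hp : ∀ i, p ∈ Metric.sphere (A i) r)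
    {s : Finset ι} {v₀ n v : E3} (hv₀ : ∀ i ∈ s, ⟪p - A i, v₀⟫ < 0)
    (hn : n ∈ unitNormalCone (⋂ i ∈ s, Metric.closedBall (A i) r) p)
    (hv : ∀ i ∈ s, ⟪p - A i, v⟫ ≤ 0) : ⟪n, v⟫ ≤ 0 := by
  have strict : ∀ w : E3, (∀ i ∈ s, ⟪p - A i, w⟫ < 0) → ⟪n, w⟫ ≤ 0 := by
    intro w hw
    have h1 : ∀ᶠ t : ℝ in 𝓝[>] 0, ∀ i ∈ s, p + t • w ∈ Metric.closedBall (A i) r :=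
      (eventually_all_finset s).2 fun i hi => eventually_mem_closedBall hr (hp i) (hw i hi)
    obtain ⟨t, h2, h3⟩ := (h1.and self_mem_nhdsWithin).exists
    have h4 := hn.2 (p + t • w) (Set.mem_iInter₂.2 h2)
    rw [add_sub_cancel_left, real_inner_smul_right] at h4
    exact nonpos_of_mul_nonpos_right h4 h3
  have hc : Tendsto (fun ε : ℝ => ⟪n, v + ε • v₀⟫) (𝓝[>] 0) (𝓝 ⟪n, v + (0 : ℝ) • v₀⟫) :=
    (Continuous.tendsto (by fun_prop) 0).mono_left nhdsWithin_le_nhds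
  rw [zero_smul, add_zero] at hc
  refine le_of_tendsto hc ?_
  filter_upwards [self_mem_nhdsWithin] with ε hε
  refine strict _ fun i hi => ?_
  rw [inner_add_right, real_inner_smul_right]
  exact add_neg_of_nonpos_of_neg (hv i hi) (mul_neg_of_pos_of_neg hε (hv₀ i hi))

end Balls

/-- The embedding of the fiber over `p` into the tangent bundle. -/
def fiberEmbedding (p n : E3) : TE3 := WithLp.toLp 2 (p, n)

theorem isometry_fiberEmbedding (p : E3) : Isometry (fiberEmbedding p) := by
  refine Isometry.of_dist_eq fun x y => ?_
  rw [WithLp.prod_dist_eq_of_L2]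
  simp [fiberEmbedding]

theorem fiberEmbedding_snd {p : E3} {z : TE3} (hz : z.fst = p) : fiberEmbedding p z.snd = z := by
  rw [← hz]
  rfl

theorem hausdorff_fiber_eq_zero {C : Set E3} {p w : E3} (hw : w ≠ 0)
    (h : ∀ n ∈ unitNormalCone C p, ⟪w, n⟫ = 0) :
    μHE[2] (unitNormalBundle C ∩ {z | z.fst ∈ ({p} : Set E3)}) = 0 := by
  refine measure_mono_null ?_ (((isometry_fiberEmbedding p).euclideanHausdorffMeasure_image _).trans
    (hausdorff_great_circle hw))
  rintro z ⟨⟨-, h2⟩, h3⟩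
  have h3 : z.fst = p := h3
  rw [h3] at h2
  exact ⟨z.snd, ⟨h2.1, h _ h2⟩, fiberEmbedding_snd h3⟩

theorem mem_frontier_of_mem_unitNormalCone {C : Set E3} {p n : E3} (hp : p ∈ C)
    (hn : n ∈ unitNormalCone C p) : p ∈ frontier C := by
  refine ⟨subset_closure hp, fun hi => ?_⟩
  have hc : Tendsto (fun t : ℝ => p + t • n) (𝓝[>] 0) (𝓝 (p + (0 : ℝ) • n)) :=
    (Continuous.tendsto (by fun_prop) 0).mono_left nhdsWithin_le_nhds
  rw [zero_smul, add_zero] at hc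
  obtain ⟨t, h1, h2⟩ := ((hc.eventually (mem_interior_iff_mem_nhds.1 hi)).and
    self_mem_nhdsWithin).exists
  have h2 : 0 < t := h2
  have h3 := hn.2 _ h1
  rw [add_sub_cancel_left, real_inner_smul_right, real_inner_self_eq_norm_sq, hn.1] at h3
  linarith

/-! ### Tangent planes of the fibers -/

/-- Increments have zero base component and satisfy `2 * ⟪n, d⟫ + ‖d‖ ^ 2 = 0`; rescaling and
passing to the limit kills the quadratic term. Conversely, a great-circle arc realizes each vertical
vector orthogonal to `n`. -/
theorem mem_posTangentConeAt_sphere_fiber {p n : E3} (hn : ‖n‖ = 1) (w : TE3) :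
    w ∈ posTangentConeAt {z : TE3 | z.fst = p ∧ ‖z.snd‖ = 1} (fiberEmbedding p n)
      ↔ w.fst = 0 ∧ ⟪n, w.snd⟫ = 0 := by
  constructor
  · intro hw
    obtain ⟨α, l, hl, c, d, hd, hmem, hcd⟩ := exists_fun_of_mem_tangentConeAt hw
    have hfst : Tendsto (fun k => (c k • d k).fst) l (𝓝 w.fst) :=
      ((WithLp.prod_continuous_ofLp 2 _ _).fst.tendsto w).comp hcd
    have hsnd : Tendsto (fun k => (c k • d k).snd) l (𝓝 w.snd) :=
      ((WithLp.prod_continuous_ofLp 2 _ _).snd.tendsto w).comp hcd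
    have hdsnd : Tendsto (fun k => (d k).snd) l (𝓝 0) :=
      ((WithLp.prod_continuous_ofLp 2 _ _).snd.tendsto 0).comp hd
    constructor
    · refine tendsto_nhds_unique (hfst.congr' ?_) tendsto_const_nhds
      filter_upwards [hmem] with k hk
      have : p + (d k).fst = p := hk.1
      have h0 : (d k).fst = 0 := by simpa using this
      change c k • (d k).fst = 0
      rw [h0, smul_zero]
    · have h1 : Tendsto (fun k => 2 * ⟪n, (c k • d k).snd⟫ + ⟪(c k • d k).snd, (d k).snd⟫) l
          (𝓝 (2 * ⟪n, w.snd⟫ + ⟪w.snd, 0⟫)) :=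
        ((tendsto_const_nhds.inner hsnd).const_mul 2).add (hsnd.inner hdsnd)
      have h2 : 2 * ⟪n, w.snd⟫ + ⟪w.snd, 0⟫ = 0 := by
        refine tendsto_nhds_unique (h1.congr' ?_) tendsto_const_nhds
        filter_upwards [hmem] with k hk
        have h3 : ‖n + (d k).snd‖ = 1 := hk.2
        have h4 := norm_add_sq_real n (d k).snd
        rw [h3, hn] at h4
        change 2 * ⟪n, (c k : ℝ) • (d k).snd⟫ + ⟪(c k : ℝ) • (d k).snd, (d k).snd⟫ = 0
        rw [real_inner_smul_left, real_inner_smul_right, real_inner_self_eq_norm_sq]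
        linear_combination -(c k : ℝ) * h4
      rw [inner_zero_right, add_zero] at h2
      linarith
  · rintro ⟨h1, h2⟩
    set y := w.snd with hy
    -- For `y = 0` the convention `0⁻¹ = 0` makes this the constant curve at `n`.
    let γ : ℝ → E3 := fun t => Real.cos (‖y‖ * t) • n + (‖y‖⁻¹ * Real.sin (‖y‖ * t)) • y
    have hγ0 : γ 0 = n := by simp [γ]
    have hγ : HasDerivAt γ y 0 := by
      have hl : HasDerivAt (fun t : ℝ => ‖y‖ * t) ‖y‖ 0 := by
        simpa using (hasDerivAt_id (0 : ℝ)).const_mul ‖y‖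
      refine ((hl.cos.smul_const n).add ((hl.sin.const_mul ‖y‖⁻¹).smul_const y)).congr_deriv ?_
      by_cases h0 : ‖y‖ = 0
      · simp [norm_eq_zero.1 h0]
      · simp [h0]
    have hnorm : ∀ t, ‖γ t‖ = 1 := by
      intro t
      rw [← pow_eq_one_iff_of_nonneg (norm_nonneg _) two_ne_zero, norm_add_sq_real, norm_smul,
        norm_smul, real_inner_smul_left, real_inner_smul_right, h2, hn]
      simp only [Real.norm_eq_abs, mul_pow, sq_abs]
      by_cases h0 : ‖y‖ = 0
      · simp [h0]
      · have hi : ‖y‖⁻¹ ^ 2 * ‖y‖ ^ 2 = 1 := by rw [← mul_pow, inv_mul_cancel₀ h0, one_pow]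
        linear_combination Real.sin (‖y‖ * t) ^ 2 * hi + Real.cos_sq_add_sin_sq (‖y‖ * t)
    have hs := hγ.tendsto_slope_zero_right
    simp only [zero_add, hγ0] at hs
    have hcont : Tendsto γ (𝓝[>] 0) (𝓝 n) := by
      have := hγ.continuousAt.tendsto
      rw [hγ0] at this
      exact this.mono_left nhdsWithin_le_nhds
    refine mem_tangentConeAt_of_seq (𝓝[>] (0 : ℝ)) (fun t => Real.toNNReal t⁻¹)
      (fun t => WithLp.toLp 2 (0, γ t - n)) ?_ ?_ ?_
    · have h3 : Tendsto (fun t => ((0 : E3), γ t - n)) (𝓝[>] 0) (𝓝 (0, 0)) := by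
        refine tendsto_const_nhds.prodMk_nhds ?_
        simpa using hcont.sub_const n
      exact ((WithLp.prod_continuous_toLp 2 _ _).tendsto _).comp h3
    · refine Eventually.of_forall fun t => ⟨?_, ?_⟩
      · simp [fiberEmbedding]
      · simp [fiberEmbedding, hnorm]
    · have h3 : Tendsto (fun t => ((0 : E3), t⁻¹ • (γ t - n))) (𝓝[>] 0) (𝓝 (w.fst, y)) := by
        rw [h1]
        exact tendsto_const_nhds.prodMk_nhds hs
      refine (((WithLp.prod_continuous_toLp 2 _ _).tendsto _).comp h3).congr' ?_
      filter_upwards [self_mem_nhdsWithin] with t ht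
      have ht : 0 < t := ht
      simp only [Function.comp_apply, NNReal.smul_def,
        Real.coe_toNNReal _ (inv_nonneg.2 ht.le), ← WithLp.toLp_smul, Prod.smul_mk, smul_zero]

theorem exists_isDirectFrame {n : E3} (hn : ‖n‖ = 1) : ∃ e, IsDirectFrame n e := by
  obtain ⟨Φ, hΦ⟩ := exists_linearIsometryEquiv_apply_eq (x := pole) (y := n)
    (by rw [norm_pole, hn])
  set a : E3 := Φ (EuclideanSpace.single 0 1) with ha
  have ha1 : ‖a‖ = 1 := by simp [ha]
  have hna : ⟪n, a⟫ = 0 := by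
    rw [← hΦ, ha, Φ.inner_map_map, inner_pole]
    simp
  have hb1 : ‖cross n a‖ = 1 := by
    rw [norm_cross, hn, ha1, inner_eq_zero_iff_angle_eq_pi_div_two _ _ |>.1 hna]
    simp
  have hab : ⟪a, cross n a⟫ = 0 := by
    rw [real_inner_comm, inner_cross, det3_eq]; ring
  have hbn : ⟪cross n a, n⟫ = 0 := by
    rw [inner_cross, det3_eq]; ring
  refine ⟨![a, cross n a], ?_, ?_⟩
  · refine ⟨fun i => ?_, fun i j hij => ?_⟩
    · fin_cases i
      · exact ha1
      · exact hb1
      · exact hn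
    · fin_cases i <;> fin_cases j
      · exact absurd rfl hij
      · exact hab
      · exact (real_inner_comm _ _).trans hna
      · exact (real_inner_comm _ _).trans hab
      · exact absurd rfl hij
      · exact hbn
      · exact hna
      · exact (real_inner_comm _ _).trans hbn
      · exact absurd rfl hij
  · have : det3 a (cross n a) n = ⟪cross n a, cross n a⟫ := by
      rw [inner_cross]
      simp only [det3_eq]
      ring
    change 0 < det3 a (cross n a) n
    rw [this, real_inner_self_eq_norm_sq, hb1]
    norm_num

theorem mem_span_ver_iff {n : E3} {e : Fin 2 → E3} (he : IsDirectFrame n e) (w : TE3) :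
    w ∈ Submodule.span ℝ (Set.range fun i => ver (e i)) ↔ w.fst = 0 ∧ ⟪n, w.snd⟫ = 0 := by
  have ho := he.1
  have h02 : ⟪n, e 0⟫ = 0 := ho.2 (show (2 : Fin 3) ≠ 0 by decide)
  have h12 : ⟪n, e 1⟫ = 0 := ho.2 (show (2 : Fin 3) ≠ 1 by decide)
  have hr : Set.range (fun i => ver (e i)) = {ver (e 0), ver (e 1)} := by
    ext x; simp [Fin.exists_fin_two, eq_comm]
  rw [hr, Submodule.mem_span_pair]
  constructor
  · rintro ⟨a, b, rfl⟩
    constructor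
    · simp [ver]
    · simp [ver, inner_add_right, real_inner_smul_right, h02, h12]
  · rintro ⟨h1, h2⟩
    let b := (basisOfOrthonormalOfCardEqFinrank ho (by simp)).toOrthonormalBasis (by simpa using ho)
    have hb : ⇑b = ![e 0, e 1, n] := by simp [b]
    have hs := b.sum_repr' w.snd
    rw [Fin.sum_univ_three, hb] at hs
    simp only [Matrix.cons_val, h2, zero_smul, add_zero] at hs
    refine ⟨⟪e 0, w.snd⟫, ⟪e 1, w.snd⟫, ?_⟩
    rw [← WithLp.ofLp_injective 2 |>.eq_iff]
    refine Prod.ext ?_ ?_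
    · simpa [ver] using h1.symm
    · simpa [ver] using hs

theorem det3_smul_smul (t : ℝ) (u v w : E3) : det3 (t • u) (t • v) w = t ^ 2 * det3 u v w := by
  simp only [det3_eq, PiLp.smul_apply, smul_eq_mul]
  ring

/-- If near `(p, n)` the set `S` is the fiber over `p` of the unit sphere bundle, then it is
oriented there by the vertical lifts of the direct frames of `n`. -/
theorem isOrientedTangentFrame_ver {S : Set TE3} {p n : E3} (hn : ‖n‖ = 1) {e : Fin 2 → E3}
    (he : IsDirectFrame n e)
    (hS : S =ᶠ[𝓝 (fiberEmbedding p n)] {z : TE3 | z.fst = p ∧ ‖z.snd‖ = 1}) :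
    IsOrientedTangentFrame S (fiberEmbedding p n) fun i => ver (e i) := by
  refine ⟨?_, ?_, ?_⟩
  · have ho := he.1
    have h0 : ‖e 0‖ = 1 := ho.1 0
    have h1 : ‖e 1‖ = 1 := ho.1 1
    have h01 : ⟪e 0, e 1⟫ = 0 := ho.2 (show (0 : Fin 3) ≠ 1 by decide)
    refine ⟨fun i => ?_, fun i j hij => ?_⟩
    · fin_cases i <;> simp [ver, h0, h1]
    · fin_cases i <;> fin_cases j
      · exact absurd rfl hij
      · simp [ver, WithLp.prod_inner_apply, h01]
      · simp [ver, WithLp.prod_inner_apply, real_inner_comm, h01]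
      · exact absurd rfl hij
  · rw [posTangentConeAt, tangentConeAt_congr (nhdsWithin_eq_iff_eventuallyEq.2 hS)]
    ext w
    exact (mem_posTangentConeAt_sphere_fiber hn w).trans (mem_span_ver_iff he w).symm
  · filter_upwards [self_mem_nhdsWithin] with t ht
    have ht : 0 < t := ht
    change 0 < det3 (0 + t • e 0) (0 + t • e 1) n
    rw [zero_add, zero_add, det3_smul_smul]
    exact mul_pos (by positivity) he.2

/-- Each wedge of the form contains a horizontal factor, which kills vertical vectors. This is why
the mean curvature measure vanishes at a vertex. -/
theorem frameForm_one_ver (e : Fin 2 → E3) : frameForm e 1 (fun i => ver (e i)) = 0 := by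
  simp [frameForm, wedge_apply, dualForm, hor, ver, WithLp.prod_inner_apply]

theorem frameForm_two_ver {n : E3} {e : Fin 2 → E3} (he : IsDirectFrame n e) :
    frameForm e 2 (fun i => ver (e i)) = 1 := by
  have ho := he.1
  have h0 : ‖e 0‖ = 1 := ho.1 0
  have h1 : ‖e 1‖ = 1 := ho.1 1
  have h01 : ⟪e 0, e 1⟫ = 0 := ho.2 (show (0 : Fin 3) ≠ 1 by decide)
  simp [frameForm, wedge_apply, dualForm, ver, WithLp.prod_inner_apply, h0, h1, h01]

/-! ### The vertex of three balls with linearly independent normals -/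

section Vertex

variable {A : Fin 3 → E3} {p : E3} {r : ℝ}

theorem inner_dualBasis {u : Fin 3 → E3} (hu : det3 (u 0) (u 1) (u 2) ≠ 0) (i j : Fin 3) :
    ⟪dualBasis u i, u j⟫ = if i = j then 1 else 0 := by
  have := inner_dualBasis_sum hu (Pi.single j 1) i
  simpa [Pi.single_apply, ite_smul] using this

/-- Polar duality: testing a normal against minus each dual vector, which is weakly inward for all
balls, shows that its coefficients in the `p - A i` are nonnegative. Conversely each `p - A i` is an
outer normal direction of the intersection. -/
theorem unitNormalCone_eq_sphericalTriangle (hr : 0 < r) (hp : ∀ i, p ∈ Metric.sphere (A i) r)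
    (hu : det3 (p - A 0) (p - A 1) (p - A 2) ≠ 0) :
    unitNormalCone (⋂ i ∈ Finset.univ, Metric.closedBall (A i) r) p
      = sphericalTriangle fun i => p - A i := by
  have hδ := inner_dualBasis (u := fun i => p - A i) hu
  apply Set.Subset.antisymm
  · rintro n hn
    rw [sphericalTriangle_eq (u := fun i => p - A i) hu]
    refine ⟨hn.1, fun i => ?_⟩
    -- Minus the sum of the dual vectors pairs to `-1` with every `p - A j`, so it is strictly
    -- inward.
    have := inner_nonpos_of_mem_unitNormalCone (v := -dualBasis (fun i => p - A i) i)
      (v₀ := -∑ j, dualBasis (fun i => p - A i) j) hr hp ?_ hn ?_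
    · rw [inner_neg_right, real_inner_comm] at this
      linarith
    · intro j _
      rw [inner_neg_right, inner_sum, Finset.sum_congr rfl fun k _ =>
        (real_inner_comm _ _).trans (hδ k j)]
      simp
    · intro j _
      rw [inner_neg_right, real_inner_comm, hδ]
      split_ifs <;> norm_num
  · rintro n ⟨h1, c, hc, rfl⟩
    refine ⟨h1, fun x hx => ?_⟩
    rw [sum_inner]
    refine Finset.sum_nonpos fun i hi => ?_
    rw [real_inner_smul_left]
    exact mul_nonpos_of_nonneg_of_nonpos (hc i)
      (inner_nonpos_of_mem_closedBall hr (hp i) (Set.mem_iInter₂.1 hx i hi))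

theorem fiber_unitNormalBundle_eq (hr : 0 < r) (hp : ∀ i, p ∈ Metric.sphere (A i) r)
    (hu : det3 (p - A 0) (p - A 1) (p - A 2) ≠ 0) :
    unitNormalBundle (⋂ i ∈ Finset.univ, Metric.closedBall (A i) r)
        ∩ {z | z.fst ∈ ({p} : Set E3)}
      = fiberEmbedding p '' sphericalTriangle fun i => p - A i := by
  rw [← unitNormalCone_eq_sphericalTriangle hr hp hu]
  ext z
  constructor
  · rintro ⟨⟨-, h2⟩, h3⟩
    have h3 : z.fst = p := h3
    rw [h3] at h2
    exact ⟨z.snd, h2, fiberEmbedding_snd h3⟩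
  · rintro ⟨n, hn, rfl⟩
    refine ⟨⟨mem_frontier_of_mem_unitNormalCone ?_ hn, hn⟩, rfl⟩
    exact Set.mem_iInter₂.2 fun i _ => Metric.sphere_subset_closedBall (hp i)

/-- Normals near `n` keep positive coefficients. At a point `q ≠ p` of the intersection each `⟪p - A
i, q - p⟫` is negative, so such a normal pairs negatively with `q - p`; being normal at `q` it would
have to pair nonnegatively. Hence the base point is `p`. -/
theorem unitNormalBundle_eventuallyEq (hr : 0 < r) (hp : ∀ i, p ∈ Metric.sphere (A i) r)
    (hu : det3 (p - A 0) (p - A 1) (p - A 2) ≠ 0) {n : E3}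
    (hn : ∀ i, 0 < ⟪dualBasis (fun i => p - A i) i, n⟫) :
    unitNormalBundle (⋂ i ∈ Finset.univ, Metric.closedBall (A i) r)
      =ᶠ[𝓝 (fiberEmbedding p n)] {z : TE3 | z.fst = p ∧ ‖z.snd‖ = 1} := by
  have hpC : p ∈ ⋂ i ∈ Finset.univ, Metric.closedBall (A i) r :=
    Set.mem_iInter₂.2 fun i _ => Metric.sphere_subset_closedBall (hp i)
  have hev : ∀ᶠ z : TE3 in 𝓝 (fiberEmbedding p n),
      ∀ i, 0 < ⟪dualBasis (fun i => p - A i) i, z.snd⟫ := by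
    refine eventually_all.2 fun i => ?_
    have hc : Continuous fun z : TE3 => ⟪dualBasis (fun i => p - A i) i, z.snd⟫ :=
      continuous_const.inner (WithLp.prod_continuous_ofLp 2 _ _).snd
    exact hc.continuousAt.eventually_const_lt (hn i)
  filter_upwards [hev] with z hz
  refine propext ⟨fun h => ?_, fun h => ?_⟩
  · refine ⟨?_, h.2.1⟩
    have hclosed : IsClosed (⋂ i ∈ Finset.univ, Metric.closedBall (A i) r) :=
      isClosed_biInter fun i _ => Metric.isClosed_closedBall
    have hq := hclosed.frontier_subset h.1
    have h1 := h.2.2 p hpC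
    have h2 : 0 ≤ ⟪z.snd, z.fst - p⟫ := by
      rw [← neg_sub, inner_neg_right] at h1
      linarith
    rw [sum_inner_dualBasis (u := fun i => p - A i) hu z.snd, sum_inner] at h2
    by_contra hne
    have h3 : 0 < ‖z.fst - p‖ := norm_pos_iff.2 (sub_ne_zero.2 hne)
    refine h2.not_gt (Finset.sum_neg (fun i hi => ?_) Finset.univ_nonempty)
    rw [real_inner_smul_left]
    have := (mem_closedBall_iff_inner hr (hp i)).1 (Set.mem_iInter₂.1 hq i hi)
    exact mul_neg_of_pos_of_neg (hz i) (by nlinarith)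
  · have : z ∈ fiberEmbedding p '' sphericalTriangle fun i => p - A i := by
      rw [sphericalTriangle_eq (u := fun i => p - A i) hu]
      exact ⟨z.snd, ⟨h.2, fun i => (hz i).le⟩, fiberEmbedding_snd h.1⟩
    rw [← fiber_unitNormalBundle_eq hr hp hu] at this
    exact this.1

theorem hausdorff_sphericalTriangle_lt_top (u : Fin 3 → E3) :
    μHE[2] (sphericalTriangle u) < ⊤ :=
  (measure_mono fun _ h => mem_sphere_zero_iff_norm.2 h.1).trans_lt hausdorff_sphere_lt_top

/-- The local description of the bundle fails at most on the three edges, which lie on great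
circles. -/
theorem ae_tangentPairing_eq (hr : 0 < r) (hp : ∀ i, p ∈ Metric.sphere (A i) r)
    (hu : det3 (p - A 0) (p - A 1) (p - A 2) ≠ 0) {k : ℕ} {a : ℝ}
    (ha : ∀ {n : E3} {e : Fin 2 → E3}, IsDirectFrame n e → frameForm e k (fun i => ver (e i)) = a) :
    ∀ᵐ z ∂μHE[2].restrict (fiberEmbedding p '' sphericalTriangle fun i => p - A i),
      tangentPairing (unitNormalBundle (⋂ i ∈ Finset.univ, Metric.closedBall (A i) r)) z
        (invariantForm k z) = a := by
  have hT := sphericalTriangle_eq (u := fun i => p - A i) hu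
  have hmeas : MeasurableSet (fiberEmbedding p '' sphericalTriangle fun i => p - A i) := by
    refine ((isometry_fiberEmbedding p).isClosedEmbedding.isClosedMap _ ?_).measurableSet
    rw [hT]
    have c1 : IsClosed {ξ : E3 | ‖ξ‖ = 1} := isClosed_eq continuous_norm continuous_const
    have c2 : IsClosed {ξ : E3 | ∀ i, 0 ≤ ⟪dualBasis (fun i => p - A i) i, ξ⟫} := by
      simp only [Set.ofPred_forall]
      exact isClosed_iInter fun i => isClosed_le continuous_const (by fun_prop)
    exact c1.inter c2
  have hd0 : ∀ i, dualBasis (fun i => p - A i) i ≠ 0 := fun i h => by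
    have := inner_dualBasis (u := fun i => p - A i) hu i i
    rw [h] at this
    simp at this
  rw [ae_restrict_iff' hmeas, ae_iff]
  refine measure_mono_null (t := fiberEmbedding p '' ⋃ i : Fin 3,
    {ξ : E3 | ‖ξ‖ = 1 ∧ ⟪dualBasis (fun i => p - A i) i, ξ⟫ = 0}) ?_ ?_
  · intro z hz
    rw [Set.mem_ofPred_eq, Classical.not_imp] at hz
    obtain ⟨⟨n, hn, rfl⟩, hz⟩ := hz
    refine ⟨n, ?_, rfl⟩
    rw [hT] at hn
    by_contra hnot
    refine hz ?_
    have hpos : ∀ i, 0 < ⟪dualBasis (fun i => p - A i) i, n⟫ := fun i =>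
      (hn.2 i).lt_of_ne fun h => hnot (Set.mem_iUnion.2 ⟨i, hn.1, h.symm⟩)
    obtain ⟨e, he⟩ := exists_isDirectFrame hn.1
    have hframe := isOrientedTangentFrame_ver hn.1 he
      (unitNormalBundle_eventuallyEq hr hp hu hpos)
    have hform : invariantForm k (fiberEmbedding p n) = frameForm e k := invariantForm_eq he
    rw [tangentPairing_eq hframe, hform]
    exact ha he
  · rw [(isometry_fiberEmbedding p).euclideanHausdorffMeasure_image]
    exact measure_iUnion_null fun i => hausdorff_great_circle (hd0 i)

theorem integrableOn_vertex (hr : 0 < r) (hp : ∀ i, p ∈ Metric.sphere (A i) r)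
    (hu : det3 (p - A 0) (p - A 1) (p - A 2) ≠ 0) {k : ℕ} {a : ℝ}
    (ha : ∀ {n : E3} {e : Fin 2 → E3}, IsDirectFrame n e → frameForm e k (fun i => ver (e i)) = a) :
    IntegrableOn
      (fun z => tangentPairing (unitNormalBundle (⋂ i ∈ Finset.univ, Metric.closedBall (A i) r)) z
        (invariantForm k z))
      (unitNormalBundle (⋂ i ∈ Finset.univ, Metric.closedBall (A i) r)
        ∩ {z | z.fst ∈ ({p} : Set E3)}) μHE[2] := by
  rw [fiber_unitNormalBundle_eq hr hp hu, IntegrableOn,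
    integrable_congr (ae_tangentPairing_eq hr hp hu ha)]
  refine integrableOn_const ?_
  rw [(isometry_fiberEmbedding p).euclideanHausdorffMeasure_image]
  exact (hausdorff_sphericalTriangle_lt_top _).ne

theorem convexNormalCycle_vertex (hr : 0 < r) (hp : ∀ i, p ∈ Metric.sphere (A i) r)
    (hu : det3 (p - A 0) (p - A 1) (p - A 2) ≠ 0) {k : ℕ} {a : ℝ}
    (ha : ∀ {n : E3} {e : Fin 2 → E3}, IsDirectFrame n e → frameForm e k (fun i => ver (e i)) = a) :
    convexNormalCycle (⋂ i ∈ Finset.univ, Metric.closedBall (A i) r)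
        {z | z.fst ∈ ({p} : Set E3)} (invariantForm k)
      = (μHE[2] : Measure E3).real (sphericalTriangle fun i => p - A i) * a := by
  rw [convexNormalCycle, fiber_unitNormalBundle_eq hr hp hu,
    integral_congr_ae (ae_tangentPairing_eq hr hp hu ha), setIntegral_const, smul_eq_mul,
    measureReal_def, (isometry_fiberEmbedding p).euclideanHausdorffMeasure_image, ← measureReal_def]

end Vertex

/-! ### Strata with at most two distinct balls -/

theorem exists_ne_zero_orthogonal_pair (a b : E3) : ∃ w : E3, w ≠ 0 ∧ ⟪w, a⟫ = 0 ∧ ⟪w, b⟫ = 0 := by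
  have hlt : Submodule.span ℝ ({a, b} : Set E3) ≠ ⊤ := by
    intro h
    have h1 := finrank_span_finset_le_card (R := ℝ) ({a, b} : Finset E3)
    have h2 := Finset.card_le_two (a := a) (b := b)
    rw [Set.finrank, Finset.coe_pair, h, finrank_top, finrank_euclideanSpace_fin] at h1
    omega
  have hbot : (Submodule.span ℝ ({a, b} : Set E3))ᗮ ≠ ⊥ := fun h =>
    hlt (Submodule.orthogonal_eq_bot_iff.1 h)
  obtain ⟨w, hw, h0⟩ := Submodule.exists_mem_ne_zero_of_ne_bot hbot
  refine ⟨w, h0, ?_, ?_⟩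
  · exact Submodule.inner_left_of_mem_orthogonal (Submodule.subset_span (by simp)) hw
  · exact Submodule.inner_left_of_mem_orthogonal (Submodule.subset_span (by simp)) hw

/-- Equal norms and non-antipodality make `-((p - A i) + (p - A j))` strictly inward for both balls.
For `w` orthogonal to both vectors, `w` and `-w` are weakly inward, so every normal is orthogonal to
`w`. -/
theorem hausdorff_fiber_pair {ι : Type*} {A : ι → E3} {p : E3} {r : ℝ} (hr : 0 < r)
    (hp : ∀ i, p ∈ Metric.sphere (A i) r) {s : Finset ι} {i j : ι}
    (hs : ∀ k ∈ s, A k = A i ∨ A k = A j) (hne : p - A i ≠ -(p - A j)) :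
    μHE[2] (unitNormalBundle (⋂ k ∈ s, Metric.closedBall (A k) r)
      ∩ {z | z.fst ∈ ({p} : Set E3)}) = 0 := by
  obtain ⟨w, hw, hi, hj⟩ := exists_ne_zero_orthogonal_pair (p - A i) (p - A j)
  have hni : ‖p - A i‖ = r := mem_sphere_iff_norm.1 (hp i)
  have hnj : ‖p - A j‖ = r := mem_sphere_iff_norm.1 (hp j)
  have hpos : 0 < r ^ 2 + ⟪p - A i, p - A j⟫ := by
    have h1 : 0 < ‖(p - A i) + (p - A j)‖ :=
      norm_pos_iff.2 fun h => hne (eq_neg_of_add_eq_zero_left h)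
    have h2 := norm_add_sq_real (p - A i) (p - A j)
    rw [hni, hnj] at h2
    nlinarith
  have hv₀ : ∀ k ∈ s, ⟪p - A k, -((p - A i) + (p - A j))⟫ < 0 := by
    intro k hk
    rw [inner_neg_right, inner_add_right]
    rcases hs k hk with h | h
    · rw [h, real_inner_self_eq_norm_sq, hni]
      linarith
    · rw [h, real_inner_self_eq_norm_sq, hnj, real_inner_comm]
      linarith
  have hw0 : ∀ k ∈ s, ⟪p - A k, w⟫ = 0 := by
    intro k hk
    rw [real_inner_comm]
    rcases hs k hk with h | h
    · rwa [h]
    · rwa [h]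
  refine hausdorff_fiber_eq_zero hw fun n hn => ?_
  have h1 := inner_nonpos_of_mem_unitNormalCone hr hp hv₀ hn fun k hk => (hw0 k hk).le
  have h2 := inner_nonpos_of_mem_unitNormalCone (v := -w) hr hp hv₀ hn fun k hk => by
    rw [inner_neg_right, hw0 k hk, neg_zero]
  rw [inner_neg_right] at h2
  rw [real_inner_comm]
  linarith

theorem integrableOn_of_measure_eq_zero {X : Type*} [MeasurableSpace X] {μ : Measure X} {s : Set X}
    (h : μ s = 0) (f : X → ℝ) : IntegrableOn f s μ := by
  rw [IntegrableOn, Measure.restrict_eq_zero.2 h]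
  exact integrable_zero_measure

theorem convexNormalCycle_eq_zero {C : Set E3} {B : Set TE3}
    (h : μHE[2] (unitNormalBundle C ∩ B) = 0) (ω : TE3 → TE3 [⋀^Fin 2]→ₗ[ℝ] ℝ) :
    convexNormalCycle C B ω = 0 :=
  setIntegral_measure_zero _ h

/-! ### General position -/

/-- If antipodal, `p` would be the midpoint of `a` and `b` with `dist a b = 2 * r`, so `r` would be
the least radius of a sphere through them. -/
theorem InGeneralPosition.not_antipodal {K : Set E3} {r : ℝ} (hK : InGeneralPosition K r)
    (hr : 0 < r) {a b p : E3} (ha : a ∈ K) (hb : b ∈ K) (hpa : p ∈ Metric.sphere a r)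
    (hpb : p ∈ Metric.sphere b r) : p - a ≠ -(p - b) := by
  intro h
  have hpa' : dist p a = r := hpa
  have hpb' : dist p b = r := hpb
  have hab : dist a b = 2 * r := by
    have e : a - b = (2 : ℝ) • (p - b) := by
      rw [two_smul, ← sub_add_sub_cancel a p b, ← neg_sub p a, h, neg_neg]
    rw [dist_eq_norm, e, norm_smul, ← dist_eq_norm, hpb']
    norm_num
  have hne : a ≠ b := by
    rintro rfl
    rw [dist_self] at hab
    linarith
  refine hK.2.2 {a, b} (Set.pair_subset ha hb) (Set.ncard_pair hne).ge
    ((Set.ncard_pair hne).le.trans (by norm_num)) ⟨⟨p, ?_⟩, ?_⟩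
  · rintro x (rfl | rfl)
    · rw [dist_comm, hpa']
    · rw [dist_comm, hpb']
  · rintro ρ ⟨c, hc⟩
    have h1 := hc a (Set.mem_insert _ _)
    have h2 := hc b (Set.mem_insert_of_mem _ rfl)
    have := dist_triangle_right a b c
    linarith

/-- Take a linear relation among the `p - A i`. If its coefficients sum to zero it is an affine
relation among three distinct cospherical points, hence trivial. Otherwise `p` is in the affine hull
of the centers, and the smallest sphere through them is centered at `p` with radius `r`, which is
excluded. -/
theorem InGeneralPosition.det3_ne_zero {A : Fin 3 → E3} {r : ℝ}
    (hA : InGeneralPosition (Set.range A) r) (hinj : Function.Injective A) {p : E3}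
    (hp : ∀ i, p ∈ Metric.sphere (A i) r) : det3 (p - A 0) (p - A 1) (p - A 2) ≠ 0 := by
  have hcard : (Set.range A).ncard = 3 := by
    rw [← Set.image_univ, Set.ncard_image_of_injective _ hinj, Set.ncard_univ]
    simp
  have hli : LinearIndependent ℝ fun i => p - A i := by
    rw [Fintype.linearIndependent_iff]
    intro c hc
    by_cases h0 : ∑ i, c i = 0
    · have hcos : EuclideanGeometry.Cospherical (Set.range A) :=
        ⟨p, r, by rintro _ ⟨i, rfl⟩; rw [dist_comm]; exact hp i⟩
      have hai := hcos.affineIndependent subset_rfl hinj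
      rw [affineIndependent_iff] at hai
      have hsum : ∑ i, c i • A i = 0 := by
        simp only [smul_sub, Finset.sum_sub_distrib, ← Finset.sum_smul, h0, zero_smul,
          zero_sub, neg_eq_zero] at hc
        exact hc
      exact fun i => hai Finset.univ c h0 hsum i (Finset.mem_univ i)
    · exfalso
      refine hA.2.2 _ subset_rfl (by rw [hcard]; norm_num) (by rw [hcard]; norm_num)
        ⟨⟨p, ?_⟩, ?_⟩
      · rintro _ ⟨i, rfl⟩
        rw [dist_comm]
        exact hp i
      · rintro ρ ⟨q, hq⟩
        have hρ : 0 ≤ ρ := by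
          rw [← hq (A 0) ⟨0, rfl⟩]
          exact dist_nonneg
        have h1 : ∀ i, ρ ^ 2 = ‖q - p‖ ^ 2 + 2 * ⟪q - p, p - A i⟫ + r ^ 2 := by
          intro i
          have hpi : ‖p - A i‖ = r := mem_sphere_iff_norm.1 (hp i)
          rw [← hq (A i) ⟨i, rfl⟩, dist_comm, dist_eq_norm, ← hpi, ← norm_add_sq_real,
            sub_add_sub_cancel]
        have h2 : ∑ i, c i * ⟪q - p, p - A i⟫ = 0 := by
          have := congrArg (fun x => ⟪q - p, x⟫) hc
          simpa only [inner_sum, real_inner_smul_right, inner_zero_right] using this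
        -- Weighting `h1` by `c` removes the linear term, leaving `ρ ^ 2 = ‖q - p‖ ^ 2 + r ^ 2`.
        have h3 : (∑ i, c i) * (ρ ^ 2 - ‖q - p‖ ^ 2 - r ^ 2) = 0 := by
          have h4 : ∑ i, c i * (ρ ^ 2 - ‖q - p‖ ^ 2 - r ^ 2)
              = ∑ i, 2 * (c i * ⟪q - p, p - A i⟫) :=
            Finset.sum_congr rfl fun i _ => by rw [h1 i]; ring
          rw [Finset.sum_mul, h4, ← Finset.mul_sum, h2, mul_zero]
        have h5 := (mul_eq_zero.1 h3).resolve_left h0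
        refine le_of_sq_le_sq ?_ hρ
        nlinarith [sq_nonneg ‖q - p‖]
  have hspan := hli.span_eq_top_of_card_eq_finrank (by simp)
  have hu := (Module.Basis.is_basis_iff_det (EuclideanSpace.basisFun (Fin 3) ℝ).toBasis).1
    ⟨hli, hspan⟩
  have hv : (fun i => p - A i) = ![p - A 0, p - A 1, p - A 2] := by
    ext1 i
    fin_cases i <;> rfl
  rw [hv] at hu
  exact hu.ne_zero

/-- The triangle is isosceles with apex `p`, and half its apex angle lies where `arcsin` inverts
`sin`. -/
theorem angle_eq_two_mul_arcsin {a b p : E3} {r : ℝ} (hr : 0 < r) (ha : p ∈ Metric.sphere a r)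
    (hb : p ∈ Metric.sphere b r) :
    EuclideanGeometry.angle a p b = 2 * Real.arcsin (dist a b / (2 * r)) := by
  have hpi := Real.pi_pos
  have h0 := EuclideanGeometry.angle_nonneg a p b
  have h1 := EuclideanGeometry.angle_le_pi a p b
  have ha' : dist a p = r := by rw [dist_comm]; exact ha
  have hb' : dist b p = r := by rw [dist_comm]; exact hb
  have hlaw := EuclideanGeometry.law_cos a p b
  rw [ha', hb'] at hlaw
  set θ := EuclideanGeometry.angle a p b
  have hs : 0 ≤ Real.sin (θ / 2) := Real.sin_nonneg_of_nonneg_of_le_pi (by linarith) (by linarith)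
  have hcos : Real.cos θ = 1 - 2 * Real.sin (θ / 2) ^ 2 := by
    have := Real.cos_two_mul (θ / 2)
    rw [show 2 * (θ / 2) = θ by ring] at this
    linarith [Real.sin_sq_add_cos_sq (θ / 2)]
  have hd : dist a b = 2 * r * Real.sin (θ / 2) := by
    rw [← sq_eq_sq₀ dist_nonneg (by positivity)]
    rw [hcos] at hlaw
    linear_combination hlaw
  rw [hd, mul_div_cancel_left₀ _ (by positivity), Real.arcsin_sin (by linarith) (by linarith)]
  ring

theorem hausdorff_sphericalTriangle_eq_zero {u : Fin 3 → E3} {i j : Fin 3}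
    (h : ∀ k, u k = u i ∨ u k = u j) : μHE[2] (sphericalTriangle u) = 0 := by
  obtain ⟨w, hw, hi, hj⟩ := exists_ne_zero_orthogonal_pair (u i) (u j)
  refine measure_mono_null ?_ (hausdorff_great_circle hw)
  rintro _ ⟨h1, c, -, rfl⟩
  refine ⟨h1, ?_⟩
  rw [inner_sum]
  refine Finset.sum_eq_zero fun k _ => ?_
  rw [real_inner_smul_right]
  rcases h k with h | h
  · rw [h, hi, mul_zero]
  · rw [h, hj, mul_zero]

end NormalCycle

/-! ### Assembly of the curvature measures at the common point -/

open NormalCycle in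
theorem mainTheorem8 (r : ℝ) (hr : 0 < r) (A : Fin 3 → NormalCycle.E3)
    (hA : NormalCycle.InGeneralPosition (Set.range A) r) (p : NormalCycle.E3)
    (hp : ∀ i, p ∈ Metric.sphere (A i) r)
    (α : Fin 3 → Fin 3 → ℝ) (hα : ∀ i j, α i j = EuclideanGeometry.angle (A i) p (A j))
    (σ : ℝ) (hσ : σ = (α 0 1 + α 1 2 + α 2 0) / 2) :
    -- the curvature measures at `{p}` are given by convergent integrals
    NormalCycle.CurvatureMeasureDefined 1 (fun i => Metric.closedBall (A i) r) {p} ∧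
    NormalCycle.CurvatureMeasureDefined 2 (fun i => Metric.closedBall (A i) r) {p} ∧
    -- the angles
    (∀ i j, α i j = 2 * Real.arcsin (dist (A i) (A j) / (2 * r))) ∧
    -- the mean curvature measure
    NormalCycle.meanCurvatureMeasure (fun i => Metric.closedBall (A i) r) {p} = 0 ∧
    -- the Gaussian curvature measure is the area of a spherical triangle
    NormalCycle.gaussianCurvatureMeasure (fun i => Metric.closedBall (A i) r) {p} =
      (MeasureTheory.Measure.euclideanHausdorffMeasure 2).real
        (NormalCycle.sphericalTriangle fun i => p - A i) ∧
    -- the Gaussian curvature measure is given by the formula of L'Huilier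
    NormalCycle.gaussianCurvatureMeasure (fun i => Metric.closedBall (A i) r) {p} =
      4 * Real.arctan (√(Real.tan (σ / 2) * Real.tan ((σ - α 0 1) / 2) *
        Real.tan ((σ - α 1 2) / 2) * Real.tan ((σ - α 0 2) / 2))) := by
  have hangle : ∀ i j, α i j = 2 * Real.arcsin (dist (A i) (A j) / (2 * r)) := fun i j => by
    rw [hα, angle_eq_two_mul_arcsin hr (hp i) (hp j)]
  have hsymm : α 0 2 = α 2 0 := by rw [hα, hα, EuclideanGeometry.angle_comm]
  have hpair : ∀ i j, p - A i ≠ -(p - A j) := fun i j =>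
    hA.not_antipodal hr ⟨i, rfl⟩ ⟨j, rfl⟩ (hp i) (hp j)
  by_cases hinj : Function.Injective A
  · have hu := hA.det3_ne_zero hinj hp
    have hnull : ∀ s : Finset (Fin 3), s ≠ Finset.univ →
        μHE[2] (unitNormalBundle (⋂ k ∈ s, Metric.closedBall (A k) r)
          ∩ {z | z.fst ∈ ({p} : Set E3)}) = 0 := by
      intro s hs
      -- A proper subset of three indices fits in a pair; `i = j` is allowed.
      have key : ∀ s : Finset (Fin 3), s ≠ Finset.univ → ∃ i j, ∀ k ∈ s, k = i ∨ k = j := by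
        decide
      obtain ⟨i, j, hij⟩ := key s hs
      exact hausdorff_fiber_pair hr hp
        (fun k hk => (hij k hk).imp (congrArg A) (congrArg A)) (hpair i j)
    have hdef : ∀ (k : ℕ) (a : ℝ), (∀ {n : E3} {e : Fin 2 → E3}, IsDirectFrame n e →
        frameForm e k (fun i => ver (e i)) = a) →
        CurvatureMeasureDefined k (fun i => Metric.closedBall (A i) r) {p} := by
      intro k a ha s _
      by_cases h : s = Finset.univ
      · subst h
        exact integrableOn_vertex hr hp hu ha
      · exact integrableOn_of_measure_eq_zero (hnull s h) _
    have hval : ∀ (k : ℕ) (a : ℝ), (∀ {n : E3} {e : Fin 2 → E3}, IsDirectFrame n e →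
        frameForm e k (fun i => ver (e i)) = a) →
        curvatureMeasure k (fun i => Metric.closedBall (A i) r) {p}
          = (μHE[2] : Measure E3).real (sphericalTriangle fun i => p - A i) * a := by
      intro k a ha
      -- Only the triple intersection has a non-null fiber; its sign is `(-1) ^ (3 + 1) = 1`.
      rw [curvatureMeasure, unionNormalCycle, Finset.sum_eq_single Finset.univ]
      · rw [convexNormalCycle_vertex hr hp hu ha]
        norm_num
      · intro s _ h
        rw [convexNormalCycle_eq_zero (hnull s h), mul_zero]
      · intro h
        exact absurd (Finset.mem_filter.2 ⟨Finset.mem_univ _, Finset.univ_nonempty⟩) h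
    have hgauss := hval 2 1 frameForm_two_ver
    rw [mul_one] at hgauss
    have hvec : ∀ i j, α i j = InnerProductGeometry.angle (p - A i) (p - A j) := fun i j => by
      rw [hα, EuclideanGeometry.angle, vsub_eq_sub, vsub_eq_sub, ← neg_sub p, ← neg_sub p,
        InnerProductGeometry.angle_neg_neg]
    refine ⟨hdef 1 0 fun _ => frameForm_one_ver _, hdef 2 1 frameForm_two_ver, hangle, ?_, hgauss,
      ?_⟩
    · exact (hval 1 0 fun _ => frameForm_one_ver _).trans (mul_zero _)
    · refine hgauss.trans ?_
      rw [hausdorff_sphericalTriangle (u := fun i => p - A i) (σ := σ) hu (hvec 1 2) (hvec 2 0)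
        (hvec 0 1) (by rw [hσ]; ring), hsymm]
      ring_nf
  -- General position constrains only the set of centers, so repetitions must be treated: all fibers
  -- and the triangle are then null.
  · have hcase : A 0 = A 1 ∨ A 1 = A 2 ∨ A 0 = A 2 := by
      rw [Function.Injective] at hinj
      push Not at hinj
      obtain ⟨i, j, h, hij⟩ := hinj
      fin_cases i <;> fin_cases j <;> simp_all
    have hdeg : ∃ i j, ∀ k, A k = A i ∨ A k = A j := by
      rcases hcase with h | h | h
      · exact ⟨1, 2, by simp [Fin.forall_fin_succ, h]⟩
      · exact ⟨0, 2, by simp [Fin.forall_fin_succ, h]⟩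
      · exact ⟨1, 2, by simp [Fin.forall_fin_succ, h]⟩
    have hzero : ∀ i j, A i = A j → α i j = 0 := fun i j h => by
      rw [hangle, h, dist_self, zero_div, Real.arcsin_zero, mul_zero]
    have hcongr : ∀ i j k, A i = A j → α i k = α j k := fun i j k h => by rw [hα, hα, h]
    have hcomm : ∀ i j, α i j = α j i := fun i j => by rw [hα, hα, EuclideanGeometry.angle_comm]
    obtain ⟨i, j, hij⟩ := hdeg
    have hnull : ∀ s : Finset (Fin 3),
        μHE[2] (unitNormalBundle (⋂ k ∈ s, Metric.closedBall (A k) r)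
          ∩ {z | z.fst ∈ ({p} : Set E3)}) = 0 := fun s =>
      hausdorff_fiber_pair hr hp (fun k _ => hij k) (hpair i j)
    have hval : ∀ k, curvatureMeasure k (fun i => Metric.closedBall (A i) r) {p} = 0 := by
      intro k
      rw [curvatureMeasure, unionNormalCycle]
      exact Finset.sum_eq_zero fun s _ => by
        rw [convexNormalCycle_eq_zero (hnull s), mul_zero]
    refine ⟨fun s _ => integrableOn_of_measure_eq_zero (hnull s) _,
      fun s _ => integrableOn_of_measure_eq_zero (hnull s) _, hangle, hval 1, ?_, ?_⟩
    · refine (hval 2).trans ?_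
      rw [measureReal_def, hausdorff_sphericalTriangle_eq_zero (i := i) (j := j),
        ENNReal.toReal_zero]
      exact fun k => (hij k).imp (fun h => by rw [h]) fun h => by rw [h]
    · refine (hval 2).trans ?_
      -- When two centers coincide, one side is `0` and the other two are equal, so `σ` equals each
      -- of those two and a tangent vanishes.
      have hprod : Real.tan ((σ - α 0 1) / 2) * Real.tan ((σ - α 1 2) / 2)
          * Real.tan ((σ - α 0 2) / 2) = 0 := by
        rcases hcase with h | h | h
        · rw [show (σ - α 1 2) / 2 = 0 by
            rw [hσ, hzero 0 1 h, hcomm 2 0, hcongr 0 1 2 h]; ring]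
          simp
        · rw [show (σ - α 0 1) / 2 = 0 by
            rw [hσ, hzero 1 2 h, hcomm 0 1, hcongr 1 2 0 h]; ring]
          simp
        · rw [show (σ - α 0 1) / 2 = 0 by
            rw [hσ, hcomm 2 0, hzero 0 2 h, hcomm 1 2, hcongr 0 2 1 h]; ring]
          simp
      rw [show Real.tan (σ / 2) * Real.tan ((σ - α 0 1) / 2) * Real.tan ((σ - α 1 2) / 2)
          * Real.tan ((σ - α 0 2) / 2) = Real.tan (σ / 2) * (Real.tan ((σ - α 0 1) / 2)
          * Real.tan ((σ - α 1 2) / 2) * Real.tan ((σ - α 0 2) / 2)) by ring, hprod]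
      simp
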